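/- Let $\Lambda$ be a left and right noetherian ring and let $n,k\ge 0$ be integers. Write $\operatorname{mod}\Lambda$ for the category of finitely generated left $\Lambda$-modules. For a left or right module $X$ let $\operatorname{Ext}^i(X,\Lambda)$ be the Ext group over $\Lambda$, resp. over $\Lambda^{op}$, which is a module on the opposite side. Put $$\operatorname{grade}X=\inf\{i\ge 0 : \operatorname{Ext}^i(X,\Lambda)\ne 0\},\qquad \operatorname{s.grade}X=\inf\{\operatorname{grade}Y : Y\subseteq X \text{ a submodule}\}.$$ For $m\ge0$ let $\Omega^m(\operatorname{mod}\Lambda)$ be the class of $C\in\operatorname{mod}\Lambda$ for which there is an exact sequence $0\to C\to P_0\to\cdots\to P_{m-1}$ in $\operatorname{mod}\Lambda$ with all $P_j$ projective (so $\Omega^0(\operatorname{mod}\Lambda)=\operatorname{mod}\Lambda$). A module $C\in\operatorname{mod}\Lambda$ is called $m$-torsionfree if $\operatorname{Ext}^j(\operatorname{Tr}C,\Lambda)=0$ for $1\le j\le m$, where $\operatorname{Tr}C$ is the cokernel of $\operatorname{Hom}_\Lambda(P_0,\Lambda)\to\operatorname{Hom}_\Lambda(P_1,\Lambda)$ for a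 presentation $P_1\to P_0\to C\to0$ by finitely generated projective modules. Consider the following conditions. (1) $\Lambda$ is $G_n(k)$, that is, $\operatorname{s.grade}\operatorname{Ext}^{i+k}(C,\Lambda)\ge i$ for every $C\in\operatorname{mod}\Lambda$ and every $1\le i\le n$. (2) For every exact sequence $0\to A\xrightarrow{f}B\to C\to0$ in $\operatorname{mod}\Lambda$ with $C\in\Omega^k(\operatorname{mod}\Lambda)$, the map $\operatorname{Ext}^i(\operatorname{Ext}^i(f,\Lambda),\Lambda)$ is a monomorphism for every $0\le i<n$. (3) For every $0\le i<n$ and every exact sequence $0\to A\to B\to C\to0$ with $A,C\in\Omega^{i+k}(\operatorname{mod}\Lambda)$, the module $B$ is $(i+1)$-torsionfree. Then (1) and (2) are equivalent. If $k>0$, then (1), (2) and (3) are equivalent. -/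

import Mathlib

open CategoryTheory CategoryTheory.Abelian Opposite

universe u

namespace AuslanderType

noncomputable section

variable {R : Type u} [Ring R]

/-- Right multiplication by `r`, as an endomorphism of the left module `R`. -/
def rightMul (r : R) : ModuleCat.of R R ⟶ ModuleCat.of R R :=
  ModuleCat.ofHom (LinearMap.toSpanSingleton R R r)

lemma rightMul_one : rightMul (1 : R) = 𝟙 _ := by
  ext; simp [rightMul]

lemma rightMul_mul (r s : R) : rightMul (r * s) = rightMul r ≫ rightMul s := by
  ext; simp [rightMul]

lemma rightMul_zero : rightMul (0 : R) = 0 := by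
  ext; simp [rightMul]

lemma rightMul_add (r s : R) : rightMul (r + s) = rightMul r + rightMul s := by
  ext; simp [rightMul]

/-- The right `R`-module structure (as a left `Rᵐᵒᵖ`-module structure) on `Ext^n_R(M, R)`,
induced by the right multiplications on the second argument. -/
instance extModule (M : ModuleCat.{u} R) (n : ℕ) :
    Module Rᵐᵒᵖ (Ext M (ModuleCat.of R R) n) where
  smul r x := x.comp (Ext.mk₀ (rightMul r.unop)) (add_zero n)
  one_smul x := by
    change x.comp (Ext.mk₀ (rightMul 1)) _ = x
    rw [rightMul_one, Ext.comp_mk₀_id]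
  mul_smul r s x := by
    change x.comp (Ext.mk₀ (rightMul (s.unop * r.unop))) _ =
      (x.comp (Ext.mk₀ (rightMul s.unop)) _).comp (Ext.mk₀ (rightMul r.unop)) _
    rw [rightMul_mul, ← Ext.mk₀_comp_mk₀, Ext.comp_assoc_of_third_deg_zero]
  smul_zero r := Ext.zero_comp _ _ _ _ _
  smul_add r x y := Ext.add_comp _ _ _ _
  add_smul r s x := by
    change x.comp (Ext.mk₀ (rightMul (r.unop + s.unop))) _ =
      x.comp (Ext.mk₀ (rightMul r.unop)) _ + x.comp (Ext.mk₀ (rightMul s.unop)) _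
    rw [rightMul_add, Ext.mk₀_add, Ext.comp_add]
  zero_smul x := by
    change x.comp (Ext.mk₀ (rightMul 0)) _ = 0
    rw [rightMul_zero, Ext.mk₀_zero, Ext.comp_zero]

variable (R) in
/-- The contravariant functor `Ext^n_R(-, R)` from left `R`-modules to right `R`-modules
(that is, left `Rᵐᵒᵖ`-modules). On morphisms it is precomposition. -/
def extDual (n : ℕ) : (ModuleCat.{u} R)ᵒᵖ ⥤ ModuleCat.{u} Rᵐᵒᵖ where
  obj M := ModuleCat.of Rᵐᵒᵖ (Ext M.unop (ModuleCat.of R R) n)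
  map f := ModuleCat.ofHom
    { toFun := fun x => (Ext.mk₀ f.unop).comp x (zero_add n)
      map_add' := fun x y => Ext.comp_add _ _ _ _
      map_smul' := fun r x =>
        (Ext.comp_assoc_of_third_deg_zero (Ext.mk₀ f.unop) x
          (Ext.mk₀ (rightMul r.unop)) (zero_add n)).symm }
  map_id M := by
    ext x
    exact Ext.mk₀_id_comp x
  map_comp f g := by
    ext x
    exact (Ext.mk₀_comp_mk₀_assoc g.unop f.unop x).symm

/-- `Ext^n_R(f, R)` for a homomorphism `f` of left modules. -/
def extMap (n : ℕ) {M N : ModuleCat.{u} R} (f : M ⟶ N) :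
    (extDual R n).obj (op N) ⟶ (extDual R n).obj (op M) :=
  (extDual R n).map f.op

/-- The grade `inf {i ≥ 0 | Ext^i_R(X, R) ≠ 0}`, with `inf ∅ = ∞`. -/
def grade (X : ModuleCat.{u} R) : ℕ∞ :=
  ⨅ (i : ℕ) (_ : Nontrivial ((extDual R i).obj (op X))), (i : ℕ∞)

/-- The strong grade: the infimum of the grades of all submodules. -/
def strongGrade (X : ModuleCat.{u} R) : ℕ∞ :=
  ⨅ Y : Submodule R X, grade (ModuleCat.of R Y)

variable (R) in
/-- The condition `G_n(k)` on `R`: the strong grade of the right module `Ext^{i+k}_R(C, R)` is at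
least `i` for every finitely generated left module `C` and `1 ≤ i ≤ n`. -/
def IsG (n k : ℕ) : Prop :=
  ∀ C : ModuleCat.{u} R, Module.Finite R C → ∀ i : ℕ, 1 ≤ i → i ≤ n →
    (i : ℕ∞) ≤ strongGrade ((extDual R (i + k)).obj (op C))

/-- `IsSyzygy n C`: the module `C` lies in `Ω^n(mod R)`, i.e. it is finitely generated and there is
an exact sequence `0 → C → P₀ → ⋯ → P_{n-1}` of finitely generated modules with all `P_i`
projective. The recursion splits off `0 → C → P₀ → D → 0` with `D` the cokernel. -/
def IsSyzygy : ℕ → ModuleCat.{u} R → Prop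
  | 0, C => Module.Finite R C
  | n + 1, C => Module.Finite R C ∧ ∃ S : ShortComplex (ModuleCat.{u} R), S.ShortExact ∧
      Nonempty (S.X₁ ≅ C) ∧ Module.Finite R S.X₂ ∧ Module.Projective R S.X₂ ∧ IsSyzygy n S.X₃

/-- The dual `f^* : Hom_R(N, R) → Hom_R(M, R)` of `f : M → N`, a homomorphism of right modules. -/
def dualMap {M N : Type u} [AddCommGroup M] [Module R M] [AddCommGroup N] [Module R N]
    (f : M →ₗ[R] N) : (N →ₗ[R] R) →ₗ[Rᵐᵒᵖ] (M →ₗ[R] R) where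
  toFun φ := φ ∘ₗ f
  map_add' _ _ := rfl
  map_smul' _ _ := rfl

/-- `IsTranspose C T`: the right module `T` is a transpose `Tr C` of `C`, i.e. it is isomorphic to
the cokernel of `P₀^* → P₁^*` for a presentation `P₁ → P₀ → C → 0` by finitely generated
projective modules. (The transpose is unique up to projective direct summands.) -/
def IsTranspose (C : ModuleCat.{u} R) (T : ModuleCat.{u} Rᵐᵒᵖ) : Prop :=
  ∃ (P₁ P₀ : ModuleCat.{u} R) (d : P₁ →ₗ[R] P₀) (e : P₀ →ₗ[R] C),
    Module.Finite R P₁ ∧ Module.Projective R P₁ ∧ Module.Finite R P₀ ∧ Module.Projective R P₀ ∧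
    Function.Exact d e ∧ Function.Surjective e ∧
    Nonempty (T ≃ₗ[Rᵐᵒᵖ] ((P₁ →ₗ[R] R) ⧸ LinearMap.range (dualMap d)))

/-- A finitely generated module `C` is `n`-torsionfree if `Ext^i(Tr C, R) = 0` for `1 ≤ i ≤ n`. -/
def IsTorsionfree (n : ℕ) (C : ModuleCat.{u} R) : Prop :=
  Module.Finite R C ∧ ∀ T : ModuleCat.{u} Rᵐᵒᵖ, IsTranspose C T →
    ∀ i : ℕ, 1 ≤ i → i ≤ n → Subsingleton ((extDual Rᵐᵒᵖ i).obj (op T))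

end

end AuslanderType

/-!
Write `E^i` for `Ext^i(-, Λ)`, and `X` for the cokernel of `B^* → A^*` attached to an exact sequence
`0 → A → B → C → 0`; it is the image of the connecting map `A^* → E^1 C`. Dimension shifting
(`isG_iff_syzygy`, `isG_iff_syzygy_one`) turns `G_n(k)` into a condition on the strong grades of
`E^i C` for `C ∈ Ω^k`, or of `E^1 D` for `D ∈ Ω^{i-1+k}`.

If `Λ` is `G_n(k)`, the long exact sequence `E^i C → E^i B → E^i A → E^{i+1} C` has outer terms of
strong grade at least `i` and `i + 1`, which forces `E^i E^i A → E^i E^i B` to be injective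
(`ext_injective_of_strongVanish`).

For the converse, let `N ⊆ E^{i+1} C` with `C ∈ Ω^k`. By induction only `E^i N = 0` is missing. The
module `N` is the image of the Yoneda product `E^0 A → E^{i+1} C` with a class in
`Ext^{i+1}(C, A)`, `A` free (`exists_range_extComp_eq`). As long as the degree of the class is above
one, `A` is embedded in a free module so that the class dies, and `A` is replaced by the cokernel:
the class is then the product of one of lower degree with the extension, and the image `N` becomes
that of `E^1 A`, `E^2 A`, and so on, which moreover embed in `E^{i+1} C`. At the end the class is an
extension `0 → A → B → C → 0` with `E^i A → N` surjective, bijective for `i > 0`, and `E^i B → N`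
zero; injectivity of `E^i E^i A → E^i E^i B` gives `E^i N = 0` (`extVanish_range_extComp`). The
embeddings exist because the torsionfreeness of `A` drops by at most one in each step, by the grade
known from the induction (`IsSES.transposeVanishUpTo_right`).

Torsionfreeness is controlled by the exact sequence `0 → X → Tr C → Tr B → Tr A → 0`
(`IsSES.exists_transpose_sequence`) and by the fact that `E^1 (Tr C) = 0` means that `C` is
torsionless (`IsPresentation.extVanish_one_iff`). With `G_n(k)` and `k > 0` the sequence shows,
by induction starting from submodules of projective modules, that modules in `Ω^{i+k}` are
`(i+1)`-torsionfree, and then that extensions of such modules are. Conversely, each submodule of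
`E^1 C` is the `X` of an extension with `A` free, and the torsionfreeness of `B` and `C` yields the
vanishing of `E^j X` for `0 < j ≤ i`, while `E^0 X = 0` holds as `B` is torsionless
(`extVanish_zero_dualCokernel`).
-/

namespace AuslanderType

noncomputable section

/-! ### Vanishing of `Ext` into the ring -/

section Vanishing

variable {R : Type u} [Ring R]

/-- Three composable linear maps forming a short exact sequence `0 → M₁ → M₂ → M₃ → 0`. -/
structure IsSES {M₁ M₂ M₃ : Type u} [AddCommGroup M₁] [Module R M₁] [AddCommGroup M₂]
    [Module R M₂] [AddCommGroup M₃] [Module R M₃] (f : M₁ →ₗ[R] M₂) (g : M₂ →ₗ[R] M₃) : Prop where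
  injective : Function.Injective f
  exact : Function.Exact f g
  surjective : Function.Surjective g

variable {M₁ M₂ M₃ : Type u} [AddCommGroup M₁] [Module R M₁] [AddCommGroup M₂]
    [Module R M₂] [AddCommGroup M₃] [Module R M₃] {f : M₁ →ₗ[R] M₂} {g : M₂ →ₗ[R] M₃}

lemma IsSES.comp_eq_zero (h : IsSES f g) : g ∘ₗ f = 0 := h.exact.linearMap_comp_eq_zero

/-- The short complex of modules attached to a short exact sequence of linear maps. -/
abbrev IsSES.shortComplex (h : IsSES f g) : ShortComplex (ModuleCat.{u} R) :=
  ShortComplex.mk (ModuleCat.ofHom f) (ModuleCat.ofHom g)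
    (by rw [← ModuleCat.ofHom_comp, h.comp_eq_zero]; rfl)

lemma IsSES.shortExact (h : IsSES f g) : h.shortComplex.ShortExact :=
  ModuleCat.shortComplex_shortExact _ h.exact h.injective h.surjective

lemma isSES_of_shortExact {S : ShortComplex (ModuleCat.{u} R)} (hS : S.ShortExact) :
    IsSES S.f.hom S.g.hom :=
  ⟨hS.moduleCat_injective_f,
    (ShortComplex.ShortExact.moduleCat_exact_iff_function_exact S).1 hS.exact,
    hS.moduleCat_surjective_g⟩

lemma isSES_subtype_mkQ (N : Submodule R M₁) : IsSES N.subtype N.mkQ :=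
  ⟨N.injective_subtype, LinearMap.exact_subtype_mkQ N, N.mkQ_surjective⟩

lemma isSES_subtype_ker {g : M₂ →ₗ[R] M₃} (hg : Function.Surjective g) :
    IsSES (LinearMap.ker g).subtype g :=
  ⟨(LinearMap.ker g).injective_subtype, LinearMap.exact_subtype_ker_map g, hg⟩

lemma isSES_rangeRestrict (g : M₂ →ₗ[R] M₃) :
    IsSES (LinearMap.ker g).subtype g.rangeRestrict := by
  have := isSES_subtype_ker g.surjective_rangeRestrict
  rwa [LinearMap.ker_rangeRestrict] at this

lemma isSES_mkQ_range {f : M₁ →ₗ[R] M₂} (hf : Function.Injective f) :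
    IsSES f (LinearMap.range f).mkQ :=
  ⟨hf, LinearMap.exact_map_mkQ_range f, (LinearMap.range f).mkQ_surjective⟩

/-- `ExtVanish R j M` says that `Ext^j_R(M, R) = 0`. -/
def ExtVanish (R : Type u) [Ring R] (j : ℕ) (M : Type u) [AddCommGroup M] [Module R M] : Prop :=
  Subsingleton (Ext (ModuleCat.of R M) (ModuleCat.of R R) j)

lemma extVanish_iff {j : ℕ} {M : Type u} [AddCommGroup M] [Module R M] :
    ExtVanish R j M ↔ ∀ x : Ext (ModuleCat.of R M) (ModuleCat.of R R) j, x = 0 :=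
  subsingleton_iff_forall_eq 0

lemma extVanish_zero_iff {M : Type u} [AddCommGroup M] [Module R M] :
    ExtVanish R 0 M ↔ ∀ φ : M →ₗ[R] R, φ = 0 := by
  rw [extVanish_iff]
  constructor
  · intro h φ
    have := (Ext.mk₀_eq_zero_iff _).1 (h (Ext.mk₀ (ModuleCat.ofHom φ)))
    simpa using congrArg ModuleCat.Hom.hom this
  · intro h x
    obtain ⟨φ, rfl⟩ := Ext.addEquiv₀.symm.surjective x
    rw [Ext.addEquiv₀_symm_apply, Ext.mk₀_eq_zero_iff]
    ext1
    exact h _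

lemma extVanish_of_projective (j : ℕ) (M : Type u) [AddCommGroup M] [Module R M]
    [Module.Projective R M] : ExtVanish R (j + 1) M :=
  haveI : Projective (ModuleCat.of R M) := (IsProjective.iff_projective M).1 inferInstance
  Ext.subsingleton_of_projective _ _ _

lemma ExtVanish.middle (h : IsSES f g) {j : ℕ} (h₁ : ExtVanish R j M₁) (h₃ : ExtVanish R j M₃) :
    ExtVanish R j M₂ := by
  rw [extVanish_iff] at *
  intro x
  obtain ⟨y, rfl⟩ := Ext.contravariant_sequence_exact₂ h.shortExact _ x (h₁ _)
  rw [h₃ y, Ext.comp_zero]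

lemma ExtVanish.left (h : IsSES f g) {j : ℕ} (h₂ : ExtVanish R j M₂)
    (h₃ : ExtVanish R (j + 1) M₃) : ExtVanish R j M₁ := by
  rw [extVanish_iff] at *
  intro x
  obtain ⟨y, rfl⟩ := Ext.contravariant_sequence_exact₁ h.shortExact _ x (add_comm 1 j) (h₃ _)
  rw [h₂ y, Ext.comp_zero]

lemma ExtVanish.right (h : IsSES f g) {j : ℕ} (h₁ : ExtVanish R j M₁)
    (h₂ : ExtVanish R (j + 1) M₂) : ExtVanish R (j + 1) M₃ := by
  rw [extVanish_iff] at *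
  intro x
  obtain ⟨y, rfl⟩ := Ext.contravariant_sequence_exact₃ h.shortExact _ x (h₂ _) (add_comm 1 j)
  rw [h₁ y, Ext.comp_zero]

lemma ExtVanish.of_surjective {g : M₂ →ₗ[R] M₃} (hg : Function.Surjective g)
    (h₂ : ExtVanish R 0 M₂) : ExtVanish R 0 M₃ := by
  rw [extVanish_zero_iff] at *
  intro φ
  rw [← LinearMap.cancel_right hg, h₂ (φ ∘ₗ g), LinearMap.zero_comp]

/-- If the identity of `M` is, up to endomorphisms factoring through a projective module, an
endomorphism factoring through `N`, then the positive-degree vanishing of `Ext` passes from `N`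
to `M`. -/
lemma ExtVanish.of_stable_retract {M N P : Type u} [AddCommGroup M] [Module R M]
    [AddCommGroup N] [Module R N] [AddCommGroup P] [Module R P] [Module.Projective R P]
    (a : M →ₗ[R] N) (b : N →ₗ[R] M) (c : M →ₗ[R] P) (d : P →ₗ[R] M)
    (h : b ∘ₗ a + d ∘ₗ c = LinearMap.id) {j : ℕ} (hN : ExtVanish R (j + 1) N) :
    ExtVanish R (j + 1) M := by
  have hP := extVanish_of_projective (R := R) j P
  rw [extVanish_iff] at *
  intro x
  have h' : ModuleCat.ofHom a ≫ ModuleCat.ofHom b + ModuleCat.ofHom c ≫ ModuleCat.ofHom d =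
      𝟙 (ModuleCat.of R M) := by
    ext m
    exact LinearMap.congr_fun h m
  rw [← Ext.mk₀_id_comp x, ← h', Ext.mk₀_add, Ext.add_comp, ← Ext.mk₀_comp_mk₀_assoc,
    ← Ext.mk₀_comp_mk₀_assoc, hN (Ext.comp _ _ _), hP (Ext.comp _ _ _), Ext.comp_zero,
    Ext.comp_zero, add_zero]

lemma ExtVanish.of_equiv {M N : Type u} [AddCommGroup M] [Module R M]
    [AddCommGroup N] [Module R N] (e : M ≃ₗ[R] N) {j : ℕ} (hN : ExtVanish R j N) :
    ExtVanish R j M := by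
  rw [extVanish_iff] at *
  intro x
  have h' : ModuleCat.ofHom e.toLinearMap ≫ ModuleCat.ofHom e.symm.toLinearMap =
      𝟙 (ModuleCat.of R M) := by
    ext m
    exact e.symm_apply_apply m
  rw [← Ext.mk₀_id_comp x, ← h', ← Ext.mk₀_comp_mk₀_assoc, hN (Ext.comp _ _ _), Ext.comp_zero]

/-- Strong grade at least `i`: `Ext^j_R(N, R) = 0` for all submodules `N ⊆ M` and all `j < i`. -/
def StrongVanish (R : Type u) [Ring R] (i : ℕ) (M : Type u) [AddCommGroup M] [Module R M] :
    Prop :=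
  ∀ N : Submodule R M, ∀ j < i, ExtVanish R j N

lemma le_grade_iff {i : ℕ} {X : ModuleCat.{u} R} :
    (i : ℕ∞) ≤ grade X ↔ ∀ j < i, ExtVanish R j X := by
  simp only [grade, le_iInf_iff, Nat.cast_le]
  refine forall_congr' fun j => ?_
  rw [← not_imp_not, not_le, not_nontrivial_iff_subsingleton]
  rfl

lemma le_strongGrade_iff {i : ℕ} {X : ModuleCat.{u} R} :
    (i : ℕ∞) ≤ strongGrade X ↔ StrongVanish R i X := by
  simp only [strongGrade, le_iInf_iff, le_grade_iff]
  rfl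

section

variable {M N : Type u} [AddCommGroup M] [Module R M] [AddCommGroup N] [Module R N]

lemma StrongVanish.extVanish_of_injective {i : ℕ} (hM : StrongVanish R i M) {f : N →ₗ[R] M}
    (hf : Function.Injective f) {j : ℕ} (hj : j < i) : ExtVanish R j N :=
  .of_equiv (LinearEquiv.ofInjective f hf) (hM _ j hj)

lemma StrongVanish.of_injective {i : ℕ} (hM : StrongVanish R i M) {f : N →ₗ[R] M}
    (hf : Function.Injective f) : StrongVanish R i N := fun K _ hj =>
  hM.extVanish_of_injective (f := f ∘ₗ K.subtype) (hf.comp K.injective_subtype) hj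

lemma StrongVanish.mono {i i' : ℕ} (hM : StrongVanish R i M) (h : i' ≤ i) :
    StrongVanish R i' M := fun K _ hj => hM K _ (hj.trans_le h)

end

/-- In an exact sequence `M₀ → M₁ → M₂ → M₃` with `M₀` of strong grade at least `i` and `M₃` of
strong grade at least `i + 1`, the middle map induces an injection on `Ext^i`. -/
lemma ext_injective_of_strongVanish {M₀ M₁ M₂ M₃ : Type u} [AddCommGroup M₀] [Module R M₀]
    [AddCommGroup M₁] [Module R M₁] [AddCommGroup M₂] [Module R M₂] [AddCommGroup M₃] [Module R M₃]
    {f : M₀ →ₗ[R] M₁} {g : M₁ →ₗ[R] M₂} {h : M₂ →ₗ[R] M₃} (hfg : Function.Exact f g)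
    (hgh : Function.Exact g h) {i : ℕ} (h₀ : StrongVanish R i M₀)
    (h₃ : StrongVanish R (i + 1) M₃)
    (x : Ext (ModuleCat.of R M₂) (ModuleCat.of R R) i)
    (hx : (Ext.mk₀ (ModuleCat.ofHom g)).comp x (zero_add i) = 0) : x = 0 := by
  have hfac : ModuleCat.ofHom g =
      ModuleCat.ofHom g.rangeRestrict ≫ ModuleCat.ofHom (LinearMap.range g).subtype := rfl
  rw [hfac, ← Ext.mk₀_comp_mk₀_assoc] at hx
  have hQ : ExtVanish R i (M₂ ⧸ LinearMap.range g) := by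
    rw [hgh.linearMap_ker_eq.symm]
    exact h₃.extVanish_of_injective (f := (LinearMap.ker h).liftQ h le_rfl)
      (LinearMap.ker_eq_bot.1 (Submodule.ker_liftQ_eq_bot _ _ _ le_rfl)) (Nat.lt_succ_self i)
  -- the kernel of `g` is a quotient of `M₀`, so its grade is bounded by that of submodules of `M₀`
  have hN : ∀ j < i, ExtVanish R j (LinearMap.ker g) := by
    rw [hfg.linearMap_ker_eq]
    intro j hj
    have hM₀ : ∀ j < i, ExtVanish R j M₀ := fun j hj =>
      h₀.extVanish_of_injective (f := LinearMap.id) Function.injective_id hj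
    cases j with
    | zero => exact (hM₀ 0 hj).of_surjective f.surjective_rangeRestrict
    | succ j =>
      exact .right (isSES_subtype_ker f.surjective_rangeRestrict) (h₀ _ j (by lia)) (hM₀ _ hj)
  have hz : (Ext.mk₀ (ModuleCat.ofHom (LinearMap.range g).subtype)).comp x (zero_add i) = 0 := by
    generalize (Ext.mk₀ (ModuleCat.ofHom (LinearMap.range g).subtype)).comp x (zero_add i) = z at hx
    cases i with
    | zero =>
      have : Epi (ModuleCat.ofHom g.rangeRestrict) :=
        (ModuleCat.epi_iff_surjective _).2 g.surjective_rangeRestrict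
      exact Ext.precomp_mk₀_injective_of_epi _ (ModuleCat.ofHom g.rangeRestrict)
        (hx.trans (Ext.comp_zero _ _ 0 0 (zero_add 0)).symm)
    | succ i =>
      obtain ⟨w, rfl⟩ := Ext.contravariant_sequence_exact₃ (isSES_rangeRestrict g).shortExact _ z hx
        (add_comm 1 i)
      rw [extVanish_iff.1 (hN i (Nat.lt_succ_self i)) w, Ext.comp_zero]
  obtain ⟨w, rfl⟩ := Ext.contravariant_sequence_exact₂
    (isSES_subtype_mkQ (LinearMap.range g)).shortExact _ x hz
  rw [extVanish_iff.1 hQ w, Ext.comp_zero]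

end Vanishing

/-! ### Duals of finitely generated modules -/

section Dual

variable {R : Type u} [Ring R]
variable {P M N : Type u} [AddCommGroup P] [Module R P] [AddCommGroup M] [Module R M]
  [AddCommGroup N] [Module R N]

lemma dualMap_apply (f : M →ₗ[R] N) (φ : N →ₗ[R] R) : dualMap f φ = φ ∘ₗ f := rfl

/-- A finitely generated projective module has a finite dual basis. -/
lemma exists_dual_basis (R : Type u) [Ring R] (P : Type u) [AddCommGroup P] [Module R P]
    [Module.Finite R P] [Module.Projective R P] :
    ∃ (n : ℕ) (x : Fin n → P) (c : Fin n → P →ₗ[R] R), ∀ p, ∑ l, c l p • x l = p := by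
  obtain ⟨n, f, hf⟩ := Module.Finite.exists_fin' R P
  obtain ⟨s, hs⟩ := Module.projective_lifting_property f LinearMap.id hf
  refine ⟨n, fun l => f (Pi.single l 1), fun l => LinearMap.proj l ∘ₗ s, fun p => ?_⟩
  have h : f (s p) = p := LinearMap.congr_fun hs p
  conv_rhs => rw [← h, pi_eq_sum_univ' (s p), map_sum]
  refine Finset.sum_congr rfl fun l _ => ?_
  rw [map_smul]
  rfl

lemma dual_eq_sum {n : ℕ} {x : Fin n → P} {c : Fin n → P →ₗ[R] R}
    (h : ∀ p, ∑ l, c l p • x l = p) (φ : P →ₗ[R] R) :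
    ∑ l, MulOpposite.op (φ (x l)) • c l = φ := by
  ext p
  conv_rhs => rw [← h p, map_sum]
  simp [LinearMap.sum_apply]

/-- A finitely generated projective module is reflexive: each functional on its dual is the
evaluation at an element. -/
lemma exists_eval_eq [Module.Finite R P] [Module.Projective R P]
    (θ : (P →ₗ[R] R) →ₗ[Rᵐᵒᵖ] Rᵐᵒᵖ) : ∃ p : P, ∀ φ, θ φ = MulOpposite.op (φ p) := by
  obtain ⟨n, x, c, h⟩ := exists_dual_basis R P
  refine ⟨∑ l, (θ (c l)).unop • x l, fun φ => ?_⟩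
  conv_lhs => rw [← dual_eq_sum h φ, map_sum]
  simp [map_sum]

/-- The evaluation at an element of `M`, as a functional on the dual of `M`. -/
def evalDual (m : M) : (M →ₗ[R] R) →ₗ[Rᵐᵒᵖ] Rᵐᵒᵖ where
  toFun φ := MulOpposite.op (φ m)
  map_add' _ _ := rfl
  map_smul' _ _ := rfl

lemma evalDual_apply (m : M) (φ : M →ₗ[R] R) : evalDual m φ = MulOpposite.op (φ m) := rfl

instance dual_projective [Module.Finite R P] [Module.Projective R P] :
    Module.Projective Rᵐᵒᵖ (P →ₗ[R] R) := by
  obtain ⟨n, x, c, h⟩ := exists_dual_basis R P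
  refine Module.Projective.of_split (P := P →ₗ[R] R) (M := Fin n → Rᵐᵒᵖ)
    (LinearMap.pi fun l => evalDual (x l)) (Fintype.linearCombination Rᵐᵒᵖ c) ?_
  ext1 φ
  exact dual_eq_sum h φ

lemma finite_dual [IsNoetherianRing Rᵐᵒᵖ] [Module.Finite R M] :
    Module.Finite Rᵐᵒᵖ (M →ₗ[R] R) := by
  obtain ⟨n, f, hf⟩ := Module.Finite.exists_fin' R M
  refine Module.Finite.of_injective (LinearMap.pi (R := Rᵐᵒᵖ) (φ := fun _ : Fin n => Rᵐᵒᵖ)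
    fun l => evalDual (M := M) (f (Pi.single l 1))) fun φ ψ hφψ => ?_
  rw [← LinearMap.cancel_right hf]
  ext l
  exact MulOpposite.op_injective (congrFun hφψ l)

variable (R) in
/-- A module is torsionless if its elements are separated by functionals. -/
def Torsionless (M : Type u) [AddCommGroup M] [Module R M] : Prop :=
  ∀ m : M, (∀ φ : M →ₗ[R] R, φ m = 0) → m = 0

lemma torsionless_of_projective [Module.Finite R P] [Module.Projective R P] :
    Torsionless R P := by
  intro p hp
  obtain ⟨n, x, c, h⟩ := exists_dual_basis R P
  rw [← h p]
  simp [hp]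

lemma Torsionless.of_injective (hN : Torsionless R N) {f : M →ₗ[R] N}
    (hf : Function.Injective f) : Torsionless R M := fun m hm =>
  hf ((hN (f m) fun φ => hm (φ ∘ₗ f)).trans (map_zero f).symm)

end Dual

/-! ### Transposes -/

section Transpose

variable {R : Type u} [Ring R]

/-- A projective presentation `P₁ → P₀ → C → 0` by finitely generated modules. -/
structure IsPresentation {P₁ P₀ C : Type u} [AddCommGroup P₁] [Module R P₁] [AddCommGroup P₀]
    [Module R P₀] [AddCommGroup C] [Module R C] (d : P₁ →ₗ[R] P₀) (e : P₀ →ₗ[R] C) : Prop where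
  finite₁ : Module.Finite R P₁
  projective₁ : Module.Projective R P₁
  finite₀ : Module.Finite R P₀
  projective₀ : Module.Projective R P₀
  exact : Function.Exact d e
  surjective : Function.Surjective e

/-- The transpose defined by a presentation with differential `d`: the cokernel of the dual
of `d`. -/
abbrev Transpose {P₁ P₀ : Type u} [AddCommGroup P₁] [Module R P₁] [AddCommGroup P₀]
    [Module R P₀] (d : P₁ →ₗ[R] P₀) : Type u :=
  (P₁ →ₗ[R] R) ⧸ LinearMap.range (dualMap d)

lemma exists_presentation [IsNoetherianRing R] (C : Type u) [AddCommGroup C] [Module R C]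
    [Module.Finite R C] : ∃ (P₁ P₀ : ModuleCat.{u} R) (d : P₁ →ₗ[R] P₀) (e : P₀ →ₗ[R] C),
      IsPresentation d e := by
  obtain ⟨n, e, he⟩ := Module.Finite.exists_fin' R C
  obtain ⟨m, d, hd⟩ := Module.Finite.exists_fin' R (LinearMap.ker e)
  refine ⟨.of R (Fin m → R), .of R (Fin n → R), (LinearMap.ker e).subtype ∘ₗ d, e,
    inferInstance, inferInstance, inferInstance, inferInstance, ?_, he⟩
  rw [LinearMap.exact_iff, LinearMap.range_comp, LinearMap.range_eq_top.2 hd, Submodule.map_top,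
    Submodule.range_subtype]

lemma exists_lift_of_exact {P M₁ M₂ M₃ : Type u} [AddCommGroup P] [Module R P]
    [Module.Projective R P] [AddCommGroup M₁] [Module R M₁] [AddCommGroup M₂] [Module R M₂]
    [AddCommGroup M₃] [Module R M₃] {d : M₁ →ₗ[R] M₂} {e : M₂ →ₗ[R] M₃}
    (h : Function.Exact d e) (u : P →ₗ[R] M₂) (hu : e ∘ₗ u = 0) : ∃ v, d ∘ₗ v = u := by
  have hu' : ∀ p, u p ∈ LinearMap.range d := fun p => (h (u p)).1 (LinearMap.congr_fun hu p)
  obtain ⟨v, hv⟩ := Module.projective_lifting_property d.rangeRestrict (u.codRestrict _ hu')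
    d.surjective_rangeRestrict
  refine ⟨v, ?_⟩
  ext p
  exact congrArg Subtype.val (LinearMap.congr_fun hv p)

section

variable {P₁ P₀ Q₁ Q₀ C : Type u} [AddCommGroup P₁] [Module R P₁] [AddCommGroup P₀]
  [Module R P₀] [AddCommGroup Q₁] [Module R Q₁] [AddCommGroup Q₀] [Module R Q₀]
  [AddCommGroup C] [Module R C] {d : P₁ →ₗ[R] P₀} {e : P₀ →ₗ[R] C} {d' : Q₁ →ₗ[R] Q₀}
  {e' : Q₀ →ₗ[R] C}

/-- Positive-degree vanishing of `Ext` on a transpose does not depend on the presentation: the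
comparison of two presentations is a homotopy equivalence up to an endomorphism of `P₁` that
vanishes after composing with `d`, and the dual of the latter makes an endomorphism of the
transpose that factors through a projective module. -/
lemma ExtVanish.transpose (h : IsPresentation d e) (h' : IsPresentation d' e') {j : ℕ}
    (hv : ExtVanish Rᵐᵒᵖ (j + 1) (Transpose d')) : ExtVanish Rᵐᵒᵖ (j + 1) (Transpose d) := by
  have := h.finite₁; have := h.projective₁; have := h.projective₀
  have := h'.projective₁; have := h'.projective₀
  obtain ⟨f₀, hf₀⟩ := Module.projective_lifting_property e' e h'.surjective
  obtain ⟨g₀, hg₀⟩ := Module.projective_lifting_property e e' h.surjective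
  obtain ⟨f₁, hf₁⟩ := exists_lift_of_exact h'.exact (f₀ ∘ₗ d) (by
    rw [← LinearMap.comp_assoc, hf₀, h.exact.linearMap_comp_eq_zero])
  obtain ⟨g₁, hg₁⟩ := exists_lift_of_exact h.exact (g₀ ∘ₗ d') (by
    rw [← LinearMap.comp_assoc, hg₀, h'.exact.linearMap_comp_eq_zero])
  obtain ⟨k, hk⟩ := exists_lift_of_exact h.exact (LinearMap.id - g₀ ∘ₗ f₀) (by
    rw [LinearMap.comp_sub, ← LinearMap.comp_assoc, hg₀, hf₀, LinearMap.comp_id, sub_self])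
  let s : P₁ →ₗ[R] P₁ := LinearMap.id - g₁ ∘ₗ f₁ - k ∘ₗ d
  have hs : d ∘ₗ s = 0 := by
    simp only [s, LinearMap.comp_sub, ← LinearMap.comp_assoc, hg₁, hk, LinearMap.comp_id,
      LinearMap.sub_comp, LinearMap.id_comp]
    rw [LinearMap.comp_assoc f₁, hf₁, ← LinearMap.comp_assoc, sub_self]
  refine ExtVanish.of_stable_retract (N := Transpose d') (P := P₁ →ₗ[R] R)
    (Submodule.mapQ _ _ (dualMap g₁) ?_) (Submodule.mapQ _ _ (dualMap f₁) ?_)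
    (Submodule.liftQ _ (dualMap s) ?_) (Submodule.mkQ _) ?_ hv
  · rintro _ ⟨φ, rfl⟩
    refine ⟨φ ∘ₗ g₀, ?_⟩
    simp only [dualMap_apply, LinearMap.comp_assoc, hg₁]
  · rintro _ ⟨φ, rfl⟩
    refine ⟨φ ∘ₗ f₀, ?_⟩
    simp only [dualMap_apply, LinearMap.comp_assoc, hf₁]
  · rintro _ ⟨φ, rfl⟩
    rw [LinearMap.mem_ker, dualMap_apply, dualMap_apply, LinearMap.comp_assoc, hs,
      LinearMap.comp_zero]
  · apply Submodule.linearMap_qext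
    ext1 φ
    change (Submodule.Quotient.mk _ : Transpose d) + Submodule.Quotient.mk _ =
      Submodule.Quotient.mk _
    rw [← Submodule.Quotient.mk_add, Submodule.Quotient.eq]
    have key : ∀ p, -φ (k (d p)) = φ (g₁ (f₁ p)) + φ (s p) - φ p := fun p => by
      simp only [s, LinearMap.sub_apply, LinearMap.id_apply, LinearMap.comp_apply, map_sub]
      abel
    exact ⟨-(φ ∘ₗ k), LinearMap.ext key⟩

end

variable (R) in
/-- All transposes of `C` have vanishing `Ext^j` into the ring. -/
def TransposeVanish (j : ℕ) (C : Type u) [AddCommGroup C] [Module R C] : Prop :=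
  ∀ (P₁ P₀ : ModuleCat.{u} R) (d : P₁ →ₗ[R] P₀) (e : P₀ →ₗ[R] C), IsPresentation d e →
    ExtVanish Rᵐᵒᵖ j (Transpose d)

lemma IsPresentation.transposeVanish_iff {P₁ P₀ C : Type u} [AddCommGroup P₁] [Module R P₁]
    [AddCommGroup P₀] [Module R P₀] [AddCommGroup C] [Module R C] {d : P₁ →ₗ[R] P₀}
    {e : P₀ →ₗ[R] C} (h : IsPresentation d e) (j : ℕ) :
    TransposeVanish R (j + 1) C ↔ ExtVanish Rᵐᵒᵖ (j + 1) (Transpose d) :=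
  ⟨fun hC => hC (.of R P₁) (.of R P₀) d e h, fun hd _ _ _ _ h' => .transpose h' h hd⟩

variable (R) in
/-- The unbundled form of `IsTorsionfree`, without the finiteness condition. -/
def TransposeVanishUpTo (t : ℕ) (C : Type u) [AddCommGroup C] [Module R C] : Prop :=
  ∀ j < t, TransposeVanish R (j + 1) C

lemma isTorsionfree_iff {t : ℕ} {C : ModuleCat.{u} R} :
    IsTorsionfree t C ↔ Module.Finite R C ∧ TransposeVanishUpTo R t C := by
  refine and_congr_right fun _ => ⟨?_, ?_⟩
  · intro h j hj P₁ P₀ d e hde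
    exact h (.of _ (Transpose d)) ⟨P₁, P₀, d, e, hde.finite₁, hde.projective₁, hde.finite₀,
      hde.projective₀, hde.exact, hde.surjective, ⟨.refl _ _⟩⟩ (j + 1) (by lia) (by lia)
  · rintro h T ⟨P₁, P₀, d, e, h₁, h₂, h₃, h₄, h₅, h₆, ⟨l⟩⟩ i hi hit
    obtain ⟨j, rfl⟩ : ∃ j, i = j + 1 := ⟨i - 1, by lia⟩
    exact ExtVanish.of_equiv l (h j (by lia) P₁ P₀ d e ⟨h₁, h₂, h₃, h₄, h₅, h₆⟩)

lemma TransposeVanish.of_projective (j : ℕ) (P : Type u) [AddCommGroup P] [Module R P]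
    [Module.Finite R P] [Module.Projective R P] : TransposeVanish R (j + 1) P := by
  have h : IsPresentation (0 : PUnit.{u + 1} →ₗ[R] P) (LinearMap.id : P →ₗ[R] P) :=
    ⟨inferInstance, inferInstance, inferInstance, inferInstance,
      LinearMap.exact_iff.2 (by simp), Function.surjective_id⟩
  rw [h.transposeVanish_iff, extVanish_iff]
  have : Subsingleton (PUnit.{u + 1} →ₗ[R] R) :=
    ⟨fun φ ψ => LinearMap.ext fun x => by rw [Subsingleton.elim x 0, map_zero, map_zero]⟩
  have : Subsingleton (Transpose (0 : PUnit.{u + 1} →ₗ[R] P)) :=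
    (Submodule.mkQ_surjective _).subsingleton
  exact fun x => extVanish_iff.1 (extVanish_of_projective j _) x

lemma extVanish_one_iff {M₁ M₂ M₃ : Type u} [AddCommGroup M₁] [Module R M₁] [AddCommGroup M₂]
    [Module R M₂] [AddCommGroup M₃] [Module R M₃] {f : M₁ →ₗ[R] M₂} {g : M₂ →ₗ[R] M₃}
    (h : IsSES f g) [Module.Projective R M₂] :
    ExtVanish R 1 M₃ ↔ ∀ θ : M₁ →ₗ[R] R, ∃ θ' : M₂ →ₗ[R] R, θ' ∘ₗ f = θ := by
  rw [extVanish_iff]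
  constructor
  · intro h₃ θ
    obtain ⟨x, hx⟩ := Ext.contravariant_sequence_exact₁ h.shortExact _
      (Ext.mk₀ (ModuleCat.ofHom θ)) (add_comm 1 0) (h₃ _)
    obtain ⟨θ', rfl⟩ := Ext.addEquiv₀.symm.surjective x
    rw [Ext.addEquiv₀_symm_apply, Ext.mk₀_comp_mk₀] at hx
    exact ⟨θ'.hom, congrArg ModuleCat.Hom.hom ((Ext.mk₀_bijective _ _).1 hx)⟩
  · intro hθ x
    obtain ⟨y, rfl⟩ := Ext.contravariant_sequence_exact₃ h.shortExact _ x
      (extVanish_iff.1 (extVanish_of_projective 0 _) _) (add_comm 1 0)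
    obtain ⟨θ, rfl⟩ := Ext.addEquiv₀.symm.surjective y
    obtain ⟨θ', hθ'⟩ := hθ θ.hom
    have : θ = ModuleCat.ofHom f ≫ ModuleCat.ofHom θ' := by
      ext1
      exact hθ'.symm
    rw [Ext.addEquiv₀_symm_apply, this, ← Ext.mk₀_comp_mk₀]
    exact h.shortExact.extClass_comp_assoc _

lemma exists_factor_of_exact {M₁ M₂ M₃ N : Type u} [AddCommGroup M₁] [Module R M₁]
    [AddCommGroup M₂] [Module R M₂] [AddCommGroup M₃] [Module R M₃] [AddCommGroup N] [Module R N]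
    {d : M₁ →ₗ[R] M₂} {e : M₂ →ₗ[R] M₃} (h : Function.Exact d e) (he : Function.Surjective e)
    (γ : M₂ →ₗ[R] N) (hγ : γ ∘ₗ d = 0) : ∃ β : M₃ →ₗ[R] N, β ∘ₗ e = γ := by
  have hle : LinearMap.ker e ≤ LinearMap.ker γ := by
    rw [h.linearMap_ker_eq]
    rintro _ ⟨p, rfl⟩
    exact LinearMap.congr_fun hγ p
  refine ⟨(LinearMap.ker e).liftQ γ hle ∘ₗ (e.quotKerEquivOfSurjective he).symm.toLinearMap, ?_⟩
  ext m
  rw [LinearMap.comp_apply, LinearMap.comp_apply, LinearEquiv.coe_coe,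
    ← LinearMap.quotKerEquivOfSurjective_apply_mk (hf := he), LinearEquiv.symm_apply_apply,
    Submodule.liftQ_apply]

/-- `Ext^1` of the transpose is the kernel of the evaluation map into the bidual. -/
lemma IsPresentation.extVanish_one_iff {P₁ P₀ C : Type u} [AddCommGroup P₁] [Module R P₁]
    [AddCommGroup P₀] [Module R P₀] [AddCommGroup C] [Module R C] {d : P₁ →ₗ[R] P₀}
    {e : P₀ →ₗ[R] C} (h : IsPresentation d e) :
    ExtVanish Rᵐᵒᵖ 1 (Transpose d) ↔ Torsionless R C := by
  have := h.finite₁; have := h.projective₁; have := h.finite₀; have := h.projective₀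
  rw [AuslanderType.extVanish_one_iff (isSES_subtype_mkQ (LinearMap.range (dualMap d)))]
  constructor
  · intro hθ c hc
    obtain ⟨p₀, rfl⟩ := h.surjective c
    -- the evaluation at `p₀` kills the functionals factoring through `C`
    have hker : ∀ φ : P₀ →ₗ[R] R, dualMap d φ = 0 → evalDual p₀ φ = 0 := by
      intro φ hφ
      obtain ⟨β, rfl⟩ := exists_factor_of_exact h.exact h.surjective φ hφ
      exact congrArg MulOpposite.op (hc β)
    have hse := isSES_rangeRestrict (dualMap d)
    have hz : evalDual (R := R) p₀ ∘ₗ (LinearMap.ker (dualMap d)).subtype = 0 :=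
      LinearMap.ext fun φ => hker φ.1 φ.2
    obtain ⟨θ, hθp⟩ := exists_factor_of_exact (R := Rᵐᵒᵖ) (M₁ := LinearMap.ker (dualMap d))
      (M₂ := P₀ →ₗ[R] R) (M₃ := LinearMap.range (dualMap d)) hse.exact hse.surjective
      (evalDual p₀) hz
    obtain ⟨θ', rfl⟩ := hθ θ
    obtain ⟨p₁, hp₁⟩ := exists_eval_eq θ'
    have hp : p₀ = d p₁ := by
      rw [← sub_eq_zero]
      refine torsionless_of_projective (R := R) _ fun φ => ?_
      rw [map_sub, sub_eq_zero]
      exact MulOpposite.op_injective ((LinearMap.congr_fun hθp φ).symm.trans (hp₁ (dualMap d φ)))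
    rw [hp]
    exact h.exact.apply_apply_eq_zero p₁
  · intro hC θ
    obtain ⟨p₀, hp₀⟩ := exists_eval_eq (θ ∘ₗ (dualMap d).rangeRestrict)
    have hep : e p₀ = 0 := hC _ fun φ => by
      have h₁ := hp₀ (φ ∘ₗ e)
      have h₂ : (dualMap d).rangeRestrict (φ ∘ₗ e) = 0 := by
        ext1
        change (φ ∘ₗ e) ∘ₗ d = 0
        rw [LinearMap.comp_assoc, h.exact.linearMap_comp_eq_zero, LinearMap.comp_zero]
      rw [LinearMap.comp_apply, h₂, map_zero] at h₁
      exact (MulOpposite.op_injective h₁).symm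
    obtain ⟨p₁, rfl⟩ := (h.exact p₀).1 hep
    refine ⟨evalDual p₁, ?_⟩
    ext ⟨_, φ, rfl⟩
    exact (hp₀ φ).symm

lemma transposeVanish_one_iff [IsNoetherianRing R] {C : Type u} [AddCommGroup C] [Module R C]
    [Module.Finite R C] : TransposeVanish R 1 C ↔ Torsionless R C := by
  obtain ⟨P₁, P₀, d, e, h⟩ := exists_presentation (R := R) C
  rw [h.transposeVanish_iff 0, h.extVanish_one_iff]

end Transpose

/-! ### Transposes in a short exact sequence -/

section TransposeSequence

variable {R : Type u} [Ring R]
variable {A B C : Type u} [AddCommGroup A] [Module R A] [AddCommGroup B] [Module R B]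
  [AddCommGroup C] [Module R C] {f : A →ₗ[R] B} {g : B →ₗ[R] C}

/-- Presentations of the outer terms of a short exact sequence `0 → A → B → C → 0` extend to one
of the middle term, and the resulting transposes form an exact sequence
`B^* → A^* → Tr C → Tr B → Tr A → 0`. -/
lemma IsSES.exists_transpose_sequence (h : IsSES f g) {P₁ P₀ Q₁ Q₀ : Type u} [AddCommGroup P₁]
    [Module R P₁] [AddCommGroup P₀] [Module R P₀] [AddCommGroup Q₁] [Module R Q₁] [AddCommGroup Q₀]
    [Module R Q₀] {dA : P₁ →ₗ[R] P₀} {eA : P₀ →ₗ[R] A} {dC : Q₁ →ₗ[R] Q₀} {eC : Q₀ →ₗ[R] C}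
    (hA : IsPresentation dA eA) (hC : IsPresentation dC eC) :
    ∃ (D : P₁ × Q₁ →ₗ[R] P₀ × Q₀) (E : P₀ × Q₀ →ₗ[R] B), IsPresentation D E ∧
      ∃ (u : (A →ₗ[R] R) →ₗ[Rᵐᵒᵖ] Transpose dC) (v : Transpose dC →ₗ[Rᵐᵒᵖ] Transpose D)
        (w : Transpose D →ₗ[Rᵐᵒᵖ] Transpose dA), Function.Exact (dualMap f) u ∧
        Function.Exact u v ∧ Function.Exact v w ∧ Function.Surjective w := by
  have := hA.finite₁; have := hA.projective₁; have := hA.finite₀; have := hA.projective₀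
  have := hC.finite₁; have := hC.projective₁; have := hC.finite₀; have := hC.projective₀
  obtain ⟨k, hk⟩ := Module.projective_lifting_property g eC h.surjective
  obtain ⟨τ, hτ⟩ := exists_lift_of_exact h.exact (-(k ∘ₗ dC)) (by
    rw [LinearMap.comp_neg, ← LinearMap.comp_assoc, hk, hC.exact.linearMap_comp_eq_zero, neg_zero])
  obtain ⟨σ, hσ⟩ := Module.projective_lifting_property eA τ hA.surjective
  have hk' : ∀ q, g (k q) = eC q := fun q => LinearMap.congr_fun hk q
  have hτ' : ∀ q, f (τ q) = -k (dC q) := fun q => LinearMap.congr_fun hτ q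
  have hσ' : ∀ q, eA (σ q) = τ q := fun q => LinearMap.congr_fun hσ q
  have hAz : ∀ p, eA (dA p) = 0 := hA.exact.apply_apply_eq_zero
  have hz : ∀ a, g (f a) = 0 := h.exact.apply_apply_eq_zero
  let D : P₁ × Q₁ →ₗ[R] P₀ × Q₀ := (dA.coprod σ).prod (dC ∘ₗ LinearMap.snd R P₁ Q₁)
  let E : P₀ × Q₀ →ₗ[R] B := (f ∘ₗ eA).coprod k
  have hD : ∀ p q, D (p, q) = (dA p + σ q, dC q) := fun p q => rfl
  have hE : ∀ p q, E (p, q) = f (eA p) + k q := fun p q => by simp [E]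
  have hex : Function.Exact D E := by
    rintro ⟨a, b⟩
    constructor
    · intro hab
      rw [hE] at hab
      have hb : eC b = 0 := by
        have := congrArg g hab
        rwa [map_add, hz, zero_add, hk', map_zero] at this
      obtain ⟨q, rfl⟩ := (hC.exact b).1 hb
      have ha : eA (a - σ q) = 0 := by
        apply h.injective
        rw [map_sub, hσ', map_sub, hτ', map_zero, sub_neg_eq_add, hab]
      obtain ⟨p, hp⟩ := (hA.exact _).1 ha
      exact ⟨(p, q), by rw [hD, hp, sub_add_cancel]⟩
    · rintro ⟨⟨p, q⟩, hpq⟩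
      rw [← hpq, hD, hE, map_add, hAz, zero_add, hσ', hτ', neg_add_cancel]
  have hsurj : Function.Surjective E := by
    intro b
    obtain ⟨q, hq⟩ := hC.surjective (g b)
    obtain ⟨a, ha⟩ := (h.exact (b - k q)).1 (by rw [map_sub, hk', hq, sub_self])
    obtain ⟨p, rfl⟩ := hA.surjective a
    exact ⟨(p, q), by rw [hE, ha, sub_add_cancel]⟩
  refine ⟨D, E, ⟨inferInstance, inferInstance, inferInstance, inferInstance, hex, hsurj⟩,
    (LinearMap.range (dualMap dC)).mkQ ∘ₗ dualMap τ,
    Submodule.mapQ _ _ (dualMap (LinearMap.snd R P₁ Q₁)) ?_,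
    Submodule.mapQ _ _ (dualMap (LinearMap.inl R P₁ Q₁)) ?_, ?_, ?_, ?_, ?_⟩
  · rintro _ ⟨φ, rfl⟩
    exact ⟨φ ∘ₗ LinearMap.snd R P₀ Q₀, rfl⟩
  · rintro _ ⟨ψ, rfl⟩
    refine ⟨ψ ∘ₗ LinearMap.inl R P₀ Q₀, ?_⟩
    ext p
    simp [dualMap_apply, hD]
  · intro α
    rw [LinearMap.comp_apply, Submodule.mkQ_apply, Submodule.Quotient.mk_eq_zero]
    constructor
    · rintro ⟨ψ, hψ⟩
      have hψ' : ∀ q, ψ (dC q) = α (τ q) := fun q => LinearMap.congr_fun hψ q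
      obtain ⟨β, hβ⟩ := exists_factor_of_exact hex hsurj ((α ∘ₗ eA).coprod (-ψ)) (by
        ext x <;> simp [hD, hAz, hσ', hψ'])
      refine ⟨β, ?_⟩
      rw [dualMap_apply, ← LinearMap.cancel_right hA.surjective]
      ext p
      have := LinearMap.congr_fun hβ (p, 0)
      rw [LinearMap.comp_apply, hE] at this
      simpa using this
    · rintro ⟨β, rfl⟩
      refine ⟨-(β ∘ₗ k), ?_⟩
      ext q
      simp [dualMap_apply, hτ']
  · intro x
    obtain ⟨φ, rfl⟩ := Submodule.mkQ_surjective _ x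
    rw [Submodule.mkQ_apply, Submodule.mapQ_apply, Submodule.Quotient.mk_eq_zero]
    constructor
    · rintro ⟨γ, hγ⟩
      have hγ' : ∀ p q, γ (dA p + σ q, dC q) = φ q := fun p q => LinearMap.congr_fun hγ (p, q)
      obtain ⟨α, hα⟩ := exists_factor_of_exact hA.exact hA.surjective
        (γ ∘ₗ LinearMap.inl R P₀ Q₀) (by
          ext p
          simpa using hγ' p 0)
      refine ⟨α, ?_⟩
      rw [LinearMap.comp_apply, Submodule.mkQ_apply, Submodule.Quotient.eq]
      refine ⟨-(γ ∘ₗ LinearMap.inr R P₀ Q₀), ?_⟩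
      ext q
      have h₁ : α (τ q) = γ (σ q, 0) := by
        rw [← hσ']
        exact LinearMap.congr_fun hα (σ q)
      have h₂ : φ q = γ (σ q, 0) + γ (0, dC q) := by
        rw [← map_add, ← hγ' 0 q]
        simp
      simp [dualMap_apply, h₁, h₂]
    · rintro ⟨α, hα⟩
      rw [LinearMap.comp_apply, Submodule.mkQ_apply, Submodule.Quotient.eq] at hα
      obtain ⟨ψ, hψ⟩ := hα
      have hψ' : ∀ q, ψ (dC q) = α (τ q) - φ q := fun q => LinearMap.congr_fun hψ q
      refine ⟨(α ∘ₗ eA).coprod (-ψ), ?_⟩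
      ext x <;> simp [dualMap_apply, hD, hAz, hσ', hψ']
  · intro x
    obtain ⟨ψ, rfl⟩ := Submodule.mkQ_surjective _ x
    rw [Submodule.mkQ_apply, Submodule.mapQ_apply, Submodule.Quotient.mk_eq_zero]
    constructor
    · rintro ⟨χ, hχ⟩
      have hχ' : ∀ p, χ (dA p) = ψ (p, 0) := fun p => LinearMap.congr_fun hχ p
      refine ⟨Submodule.Quotient.mk (ψ ∘ₗ LinearMap.inr R P₁ Q₁ - χ ∘ₗ σ), ?_⟩
      rw [Submodule.mapQ_apply, Submodule.Quotient.eq]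
      refine ⟨-(χ ∘ₗ LinearMap.fst R P₀ Q₀), ?_⟩
      have hψ₀ : ψ (0, 0) = 0 := map_zero ψ
      ext x <;> simp [dualMap_apply, hD, hχ', hψ₀]
    · rintro ⟨y, hy⟩
      obtain ⟨φ, rfl⟩ := Submodule.mkQ_surjective _ y
      rw [Submodule.mkQ_apply, Submodule.mapQ_apply, Submodule.Quotient.eq] at hy
      obtain ⟨χ, hχ⟩ := hy
      refine ⟨-(χ ∘ₗ LinearMap.inl R P₀ Q₀), ?_⟩
      ext p
      have := LinearMap.congr_fun hχ (p, 0)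
      simp only [dualMap_apply, LinearMap.comp_apply, hD, LinearMap.sub_apply] at this
      simp only [dualMap_apply, LinearMap.comp_apply, LinearMap.neg_apply, LinearMap.inl_apply]
      simp only [map_zero, add_zero, LinearMap.snd_apply, zero_sub] at this
      rw [this, neg_neg]
  · intro x
    obtain ⟨φ, rfl⟩ := Submodule.mkQ_surjective _ x
    refine ⟨Submodule.Quotient.mk (φ ∘ₗ LinearMap.fst R P₁ Q₁), ?_⟩
    rw [Submodule.mapQ_apply, Submodule.mkQ_apply]
    congr 1

/-- The cokernel of the restriction of functionals `B^* → A^*`, for `f : A → B`. -/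
abbrev DualCokernel (f : A →ₗ[R] B) : Type u := (A →ₗ[R] R) ⧸ LinearMap.range (dualMap f)

/-- For `0 → A → B → C → 0` with `X` the cokernel of `B^* → A^*`, there are short exact sequences
`0 → X → Tr C → W → 0` and `0 → W → Tr B → Tr A → 0`. -/
lemma IsSES.exists_transpose_isSES [IsNoetherianRing R] [Module.Finite R A] [Module.Finite R C]
    (h : IsSES f g) :
    ∃ (TA TB TC W : ModuleCat.{u} Rᵐᵒᵖ) (i : DualCokernel f →ₗ[Rᵐᵒᵖ] TC) (p : TC →ₗ[Rᵐᵒᵖ] W)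
      (q : W →ₗ[Rᵐᵒᵖ] TB) (w : TB →ₗ[Rᵐᵒᵖ] TA), IsSES i p ∧ IsSES q w ∧
      (∀ j, TransposeVanish R (j + 1) A ↔ ExtVanish Rᵐᵒᵖ (j + 1) TA) ∧
      (∀ j, TransposeVanish R (j + 1) B ↔ ExtVanish Rᵐᵒᵖ (j + 1) TB) ∧
      (∀ j, TransposeVanish R (j + 1) C ↔ ExtVanish Rᵐᵒᵖ (j + 1) TC) := by
  obtain ⟨P₁, P₀, dA, eA, hA⟩ := exists_presentation (R := R) A
  obtain ⟨Q₁, Q₀, dC, eC, hC⟩ := exists_presentation (R := R) C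
  obtain ⟨D, E, hB, u, v, w, h₁, h₂, h₃, h₄⟩ := h.exists_transpose_sequence hA hC
  have hker : LinearMap.ker u = LinearMap.range (dualMap f) := h₁.linearMap_ker_eq
  refine ⟨.of _ (Transpose dA), .of _ (Transpose D), .of _ (Transpose dC),
    .of _ (LinearMap.range v), (LinearMap.range (dualMap f)).liftQ u hker.ge, v.rangeRestrict,
    (LinearMap.range v).subtype, w, ⟨?_, ?_, v.surjective_rangeRestrict⟩,
    ⟨Submodule.injective_subtype _, ?_, h₄⟩, hA.transposeVanish_iff, hB.transposeVanish_iff,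
    hC.transposeVanish_iff⟩
  · exact LinearMap.ker_eq_bot.1 (Submodule.ker_liftQ_eq_bot _ _ _ hker.le)
  · rw [LinearMap.exact_iff, LinearMap.ker_rangeRestrict, Submodule.range_liftQ,
      h₂.linearMap_ker_eq]
  · rw [LinearMap.exact_iff, Submodule.range_subtype, h₃.linearMap_ker_eq]

/-- If `A` is finitely generated projective and embeds in a torsionless module, then each
functional on the cokernel of the restriction of functionals is the evaluation at an element of
`A` which all functionals of `B` kill, hence zero. -/
lemma extVanish_zero_dualCokernel [Module.Finite R A] [Module.Projective R A]
    (hf : Function.Injective f) (hB : Torsionless R B) :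
    ExtVanish Rᵐᵒᵖ 0 (DualCokernel f) := by
  rw [extVanish_zero_iff]
  intro θ
  obtain ⟨a, ha⟩ := exists_eval_eq (θ ∘ₗ (LinearMap.range (dualMap f)).mkQ)
  have ha₀ : a = 0 := hf <| (hB _ fun φ => by
    have h₁ := ha (φ ∘ₗ f)
    have h₂ : (LinearMap.range (dualMap f)).mkQ (φ ∘ₗ f) = 0 :=
      (Submodule.Quotient.mk_eq_zero _).2 ⟨φ, rfl⟩
    rw [LinearMap.comp_apply, h₂, map_zero] at h₁
    exact (MulOpposite.op_injective h₁).symm).trans (map_zero f).symm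
  rw [← LinearMap.cancel_right (Submodule.mkQ_surjective _)]
  ext1 φ
  rw [ha, ha₀, map_zero]
  rfl

variable [IsNoetherianRing R] [Module.Finite R A] [Module.Finite R C]

lemma IsSES.transposeVanishUpTo_middle (h : IsSES f g) {t : ℕ}
    (hX : ∀ j < t, ExtVanish Rᵐᵒᵖ j (DualCokernel f)) (hA : TransposeVanishUpTo R t A)
    (hC : TransposeVanishUpTo R t C) : TransposeVanishUpTo R t B := by
  obtain ⟨TA, TB, TC, W, i, p, q, w, h₁, h₂, eA, eB, eC⟩ := h.exists_transpose_isSES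
  intro j hj
  rw [eB]
  exact .middle h₂ (.right h₁ (hX j hj) ((eC j).1 (hC j hj))) ((eA j).1 (hA j hj))

lemma IsSES.extVanish_dualCokernel (h : IsSES f g) {t : ℕ}
    (hA : ∀ j, TransposeVanish R (j + 1) A) (hB : TransposeVanishUpTo R (t + 1) B)
    (hC : TransposeVanishUpTo R t C) {j : ℕ} (hj : j < t) :
    ExtVanish Rᵐᵒᵖ (j + 1) (DualCokernel f) := by
  obtain ⟨TA, TB, TC, W, i, p, q, w, h₁, h₂, eA, eB, eC⟩ := h.exists_transpose_isSES
  exact .left h₁ ((eC j).1 (hC j hj))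
    (.left h₂ ((eB (j + 1)).1 (hB (j + 1) (by lia))) ((eA (j + 2)).1 (hA (j + 2))))

/-- A syzygy of a `t`-torsionfree module is `(t + 1)`-torsionfree if the cokernel of the
restriction of functionals has grade at least `t`. -/
lemma IsSES.transposeVanishUpTo_left [Module.Finite R B] [Module.Projective R B] (h : IsSES f g)
    {t : ℕ} (hX : ∀ j < t, ExtVanish Rᵐᵒᵖ j (DualCokernel f)) (hC : TransposeVanishUpTo R t C) :
    TransposeVanishUpTo R (t + 1) A := by
  obtain ⟨TA, TB, TC, W, i, p, q, w, h₁, h₂, eA, eB, eC⟩ := h.exists_transpose_isSES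
  rintro (_ | j) hj
  · exact transposeVanish_one_iff.2 (torsionless_of_projective.of_injective h.injective)
  · rw [eA]
    refine .right h₂ (.right h₁ (hX j (by lia)) ((eC j).1 (hC j (by lia)))) ?_
    exact (eB _).1 (.of_projective _ B)

/-- The cokernel of an embedding of a `(t + 1)`-torsionfree module into a projective module is
`t`-torsionfree if the cokernel of the restriction of functionals has grade at least `t + 1`. -/
lemma IsSES.transposeVanishUpTo_right [Module.Finite R B] [Module.Projective R B] (h : IsSES f g)
    {t : ℕ} (hX : ∀ j < t + 1, ExtVanish Rᵐᵒᵖ j (DualCokernel f))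
    (hA : TransposeVanishUpTo R (t + 1) A) : TransposeVanishUpTo R t C := by
  obtain ⟨TA, TB, TC, W, i, p, q, w, h₁, h₂, eA, eB, eC⟩ := h.exists_transpose_isSES
  intro j hj
  rw [eC]
  refine .middle h₁ (hX (j + 1) (by lia)) (.left h₂ ?_ ((eA (j + 1)).1 (hA (j + 1) (by lia))))
  exact (eB _).1 (.of_projective _ B)

end TransposeSequence

/-! ### `Ext` into the ring as a module over the opposite ring -/

section ExtModule

variable {R : Type u} [Ring R]

lemma ext_op_smul_def {M : ModuleCat.{u} R} {n : ℕ} (r : Rᵐᵒᵖ)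
    (x : Ext M (ModuleCat.of R R) n) :
    r • x = x.comp (Ext.mk₀ (rightMul r.unop)) (add_zero n) := rfl

/-- Yoneda product with a fixed class `y`, as a map `Ext^j(A, R) → Ext^i(C, R)` of right
modules. -/
def extComp {C A : ModuleCat.{u} R} {s j i : ℕ} (y : Ext C A s) (h : s + j = i) :
    Ext A (ModuleCat.of R R) j →ₗ[Rᵐᵒᵖ] Ext C (ModuleCat.of R R) i where
  toFun z := y.comp z h
  map_add' _ _ := Ext.comp_add _ _ _ _
  map_smul' r z :=
    (Ext.comp_assoc_of_third_deg_zero y z (Ext.mk₀ (rightMul r.unop)) h).symm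

@[simp]
lemma extComp_apply {C A : ModuleCat.{u} R} {s j i : ℕ} (y : Ext C A s) (h : s + j = i)
    (z : Ext A (ModuleCat.of R R) j) : extComp y h z = y.comp z h := rfl

/-- `Ext^0(M, R)` is the dual of `M`, as a right module. -/
def dualEquivExt (M : ModuleCat.{u} R) :
    (M →ₗ[R] R) ≃ₗ[Rᵐᵒᵖ] Ext M (ModuleCat.of R R) 0 where
  toFun φ := Ext.mk₀ (ModuleCat.ofHom φ)
  map_add' _ _ := Ext.mk₀_add _ _
  map_smul' r φ := by
    rw [RingHom.id_apply, ext_op_smul_def, Ext.mk₀_comp_mk₀]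
    rfl
  invFun x := (Ext.addEquiv₀ x).hom
  left_inv φ := congrArg ModuleCat.Hom.hom (Ext.addEquiv₀.apply_symm_apply (ModuleCat.ofHom φ))
  right_inv x := Ext.addEquiv₀.symm_apply_apply x

lemma dualEquivExt_apply {M : ModuleCat.{u} R} (φ : M →ₗ[R] R) :
    dualEquivExt M φ = Ext.mk₀ (ModuleCat.ofHom φ) := rfl

lemma ext_eq_zero_of_projective {P Y : ModuleCat.{u} R} [Module.Projective R P] {j : ℕ}
    (x : Ext P Y (j + 1)) : x = 0 :=
  haveI : Projective P := (IsProjective.iff_projective _).1 ‹_›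
  Ext.eq_zero_of_projective x

section ShortExact

variable {S : ShortComplex (ModuleCat.{u} R)} (hS : S.ShortExact)

lemma extComp_extClass_surjective [Module.Projective R S.X₂] {j i : ℕ} (h : 1 + j = i) :
    Function.Surjective (extComp hS.extClass h) := fun x => by
  obtain rfl : i = j + 1 := by lia
  exact Ext.contravariant_sequence_exact₃ hS _ x (ext_eq_zero_of_projective _) h

lemma extComp_extClass_injective [Module.Projective R S.X₂] {j i : ℕ} (h : 1 + (j + 1) = i) :
    Function.Injective (extComp hS.extClass h) := by
  rw [injective_iff_map_eq_zero]
  intro x hx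
  obtain ⟨y, rfl⟩ := Ext.contravariant_sequence_exact₁ hS _ x h hx
  rw [ext_eq_zero_of_projective y, Ext.comp_zero]

/-- Dimension shifting along a projective middle term. -/
def extShiftEquiv [Module.Projective R S.X₂] {j i : ℕ} (h : 1 + (j + 1) = i) :
    Ext S.X₁ (ModuleCat.of R R) (j + 1) ≃ₗ[Rᵐᵒᵖ] Ext S.X₃ (ModuleCat.of R R) i :=
  .ofBijective (extComp hS.extClass h)
    ⟨extComp_extClass_injective hS h, extComp_extClass_surjective hS h⟩

/-- The cokernel of the restriction of functionals along the first map of a short exact sequence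
is identified with the image of the connecting map into `Ext^1`. -/
lemma exists_dualCokernel_embedding :
    ∃ ι : DualCokernel S.f.hom →ₗ[Rᵐᵒᵖ] Ext S.X₃ (ModuleCat.of R R) 1, Function.Injective ι ∧
      LinearMap.range ι = LinearMap.range (extComp hS.extClass (add_zero 1)) := by
  let δ : (S.X₁ →ₗ[R] R) →ₗ[Rᵐᵒᵖ] Ext S.X₃ (ModuleCat.of R R) 1 :=
    extComp hS.extClass (add_zero 1) ∘ₗ (dualEquivExt S.X₁).toLinearMap
  have hker : LinearMap.ker δ = LinearMap.range (dualMap S.f.hom) := by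
    ext α
    constructor
    · intro hα
      obtain ⟨x, hx⟩ := Ext.contravariant_sequence_exact₁ hS _ _ (add_zero 1) hα
      obtain ⟨β, rfl⟩ := (dualEquivExt S.X₂).surjective x
      refine ⟨β, (dualEquivExt S.X₁).injective ?_⟩
      rw [dualEquivExt_apply, Ext.mk₀_comp_mk₀] at hx
      exact hx
    · rintro ⟨β, rfl⟩
      have : Ext.mk₀ (ModuleCat.ofHom (dualMap S.f.hom β)) =
          (Ext.mk₀ S.f).comp (Ext.mk₀ (ModuleCat.ofHom β)) (zero_add 0) := by
        rw [Ext.mk₀_comp_mk₀]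
        rfl
      change hS.extClass.comp (Ext.mk₀ (ModuleCat.ofHom (dualMap S.f.hom β))) (add_zero 1) = 0
      rw [this]
      exact hS.extClass_comp_assoc _
  refine ⟨(LinearMap.range (dualMap S.f.hom)).liftQ δ hker.ge, ?_, ?_⟩
  · exact LinearMap.ker_eq_bot.1 (Submodule.ker_liftQ_eq_bot _ _ _ hker.le)
  · rw [Submodule.range_liftQ, LinearMap.range_comp, LinearEquiv.range, Submodule.map_top]

end ShortExact

lemma exists_projective_isSES [IsNoetherianRing R] (C : ModuleCat.{u} R) [Module.Finite R C] :
    ∃ (K P : ModuleCat.{u} R) (f : K →ₗ[R] P) (g : P →ₗ[R] C), IsSES f g ∧ Module.Finite R K ∧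
      Module.Finite R P ∧ Module.Projective R P := by
  obtain ⟨n, g, hg⟩ := Module.Finite.exists_fin' R C
  exact ⟨.of R (LinearMap.ker g), .of R (Fin n → R), (LinearMap.ker g).subtype, g,
    isSES_subtype_ker hg, inferInstanceAs (Module.Finite R (LinearMap.ker g)),
    inferInstanceAs (Module.Finite R (Fin n → R)),
    inferInstanceAs (Module.Projective R (Fin n → R))⟩

lemma finite_ext [IsNoetherianRing R] [IsNoetherianRing Rᵐᵒᵖ] (C : ModuleCat.{u} R)
    [Module.Finite R C] (i : ℕ) : Module.Finite Rᵐᵒᵖ (Ext C (ModuleCat.of R R) i) := by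
  induction i generalizing C with
  | zero =>
    have : Module.Finite Rᵐᵒᵖ (C →ₗ[R] R) := finite_dual
    exact Module.Finite.equiv (dualEquivExt C)
  | succ i ih =>
    obtain ⟨K, P, f, g, h, hK, hP, hP'⟩ := exists_projective_isSES C
    have := ih K
    have : Module.Projective R h.shortComplex.X₂ := hP'
    exact Module.Finite.of_surjective (extComp h.shortExact.extClass (add_comm 1 i))
      (extComp_extClass_surjective h.shortExact _)

/-- Each class in `Ext^1(C, A)` comes from a short exact sequence, which is a pushout of a
projective presentation of `C`. -/
lemma exists_extClass_eq [IsNoetherianRing R] {C A : ModuleCat.{u} R} [Module.Finite R C]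
    [Module.Finite R A] (y : Ext C A 1) :
    ∃ (B : ModuleCat.{u} R) (f : A →ₗ[R] B) (g : B →ₗ[R] C) (h : IsSES f g),
      Module.Finite R B ∧ h.shortExact.extClass = y := by
  obtain ⟨K, P, k, p, h, hK, hP, hP'⟩ := exists_projective_isSES C
  obtain ⟨x, hx⟩ := Ext.contravariant_sequence_exact₃ h.shortExact _ y
    (ext_eq_zero_of_projective (P := P) _) (add_zero 1)
  obtain ⟨a, rfl⟩ := Ext.addEquiv₀.symm.surjective x
  let N : Submodule R (A × P) := LinearMap.range (a.hom.prod (-k))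
  let f : A →ₗ[R] (A × P) ⧸ N := N.mkQ ∘ₗ LinearMap.inl R A P
  let g : ((A × P) ⧸ N) →ₗ[R] C := N.liftQ (p ∘ₗ LinearMap.snd R A P) (by
    rintro _ ⟨z, rfl⟩
    change p (-k z) = 0
    rw [map_neg, h.exact.apply_apply_eq_zero, neg_zero])
  have hfg : IsSES f g := by
    refine ⟨?_, ?_, fun c => ?_⟩
    · rw [injective_iff_map_eq_zero]
      intro b hb
      obtain ⟨z, hz⟩ := (Submodule.Quotient.mk_eq_zero N).1 hb
      have h₁ : a.hom z = b := congrArg Prod.fst hz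
      have h₂ : -k z = 0 := congrArg Prod.snd hz
      rw [← h₁, h.injective ((neg_eq_zero.1 h₂).trans (map_zero k).symm), map_zero]
    · intro q
      obtain ⟨⟨b, c⟩, rfl⟩ := N.mkQ_surjective q
      constructor
      · intro hq
        obtain ⟨z, rfl⟩ := (h.exact c).1 hq
        refine ⟨b + a.hom z, (Submodule.Quotient.eq N).2 ⟨z, ?_⟩⟩
        ext
        · simp
        · simp
      · rintro ⟨b', hb'⟩
        rw [← hb']
        exact map_zero p
    · obtain ⟨c', rfl⟩ := h.surjective c
      exact ⟨N.mkQ (0, c'), rfl⟩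
  refine ⟨.of R ((A × P) ⧸ N), f, g, hfg, inferInstanceAs (Module.Finite R ((A × P) ⧸ N)), ?_⟩
  let m : h.shortComplex ⟶ hfg.shortComplex :=
    { τ₁ := a
      τ₂ := ModuleCat.ofHom (N.mkQ ∘ₗ LinearMap.inr R A P)
      τ₃ := 𝟙 C
      comm₁₂ := by
        ext z
        refine (Submodule.Quotient.eq N).2 ⟨z, ?_⟩
        ext
        · simp
          rfl
        · simp
          rfl
      comm₂₃ := rfl }
  have := ShortComplex.ShortExact.extClass_naturality h.shortExact hfg.shortExact m
  rw [← hx, ← Ext.mk₀_id_comp hfg.shortExact.extClass]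
  exact this.symm

/-- Finitely many classes in `Ext^i(C, R)` are the components of one class with coefficients in a
free module, whose Yoneda products with functionals span the same submodule. -/
lemma exists_range_extComp_eq {C : ModuleCat.{u} R} {i : ℕ}
    {X : Submodule Rᵐᵒᵖ (Ext C (ModuleCat.of R R) i)} (hX : X.FG) :
    ∃ (m : ℕ) (y : Ext C (ModuleCat.of R (Fin m → R)) i),
      LinearMap.range (extComp y (add_zero i)) = X := by
  obtain ⟨m, x, rfl⟩ := Submodule.fg_iff_exists_fin_generating_family.1 hX
  let y : Ext C (ModuleCat.of R (Fin m → R)) i :=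
    ∑ l, (x l).comp (Ext.mk₀ (ModuleCat.ofHom (LinearMap.single R (fun _ : Fin m => R) l)))
      (add_zero i)
  have hy : ∀ φ : (Fin m → R) →ₗ[R] R,
      extComp y (add_zero i) (dualEquivExt (.of R (Fin m → R)) φ) =
        ∑ l, MulOpposite.op (φ (Pi.single l 1)) • x l := by
    intro φ
    rw [dualEquivExt_apply, extComp_apply, Ext.sum_comp]
    refine Finset.sum_congr rfl fun l _ => ?_
    rw [Ext.comp_assoc_of_third_deg_zero, Ext.mk₀_comp_mk₀, ext_op_smul_def]
    congr 2
    ext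
    simp [rightMul]
  refine ⟨m, y, ?_⟩
  ext z
  rw [Submodule.mem_span_range_iff_exists_fun, LinearMap.mem_range]
  constructor
  · rintro ⟨w, rfl⟩
    obtain ⟨φ, rfl⟩ := (dualEquivExt (.of R (Fin m → R))).surjective w
    exact ⟨_, (hy φ).symm⟩
  · rintro ⟨c, rfl⟩
    refine ⟨dualEquivExt _ (Fintype.linearCombination R fun l => (c l).unop), ?_⟩
    rw [hy]
    refine Finset.sum_congr rfl fun l _ => ?_
    simp [Fintype.linearCombination_apply_single]

lemma comp_mk₀_pi_eq_zero {C A : ModuleCat.{u} R} {s m : ℕ} (y : Ext C A s)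
    (φ : Fin m → A →ₗ[R] R) (hφ : ∀ l, extComp y (add_zero s) (dualEquivExt A (φ l)) = 0) :
    y.comp (Ext.mk₀ (ModuleCat.ofHom (LinearMap.pi φ))) (add_zero s) = 0 := by
  have : ModuleCat.ofHom (LinearMap.pi φ) = ∑ l, ModuleCat.ofHom (φ l) ≫
      ModuleCat.ofHom (LinearMap.single R (fun _ : Fin m => R) l) := by
    ext a
    simp [ModuleCat.hom_sum, LinearMap.sum_apply, LinearMap.pi_apply]
  rw [this, Ext.mk₀_sum, Ext.comp_sum]
  refine Finset.sum_eq_zero fun l _ => ?_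
  rw [← Ext.mk₀_comp_mk₀, ← Ext.comp_assoc_of_third_deg_zero]
  exact (congrArg (fun z => Ext.comp z _ _) (hφ l)).trans (Ext.zero_comp _ _ _ _ _)

end ExtModule

/-! ### Syzygies -/

section Syzygy

variable {R : Type u} [Ring R]

lemma IsSyzygy.finite : ∀ {k : ℕ} {C : ModuleCat.{u} R}, IsSyzygy k C → Module.Finite R C
  | 0, _, h => h
  | _ + 1, _, h => h.1

lemma IsSyzygy.of_succ {k : ℕ} {C : ModuleCat.{u} R} (h : IsSyzygy (k + 1) C) :
    IsSyzygy k C := by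
  induction k generalizing C with
  | zero => exact h.1
  | succ k ih =>
    obtain ⟨hC, S, hS, e, h₁, h₂, h₃⟩ := h
    exact ⟨hC, S, hS, e, h₁, h₂, ih h₃⟩

lemma IsSES.isSyzygy_succ {A B C : ModuleCat.{u} R} {f : A →ₗ[R] B} {g : B →ₗ[R] C}
    (h : IsSES f g) (hA : Module.Finite R A) (hB : Module.Finite R B)
    (hB' : Module.Projective R B) {k : ℕ} (hC : IsSyzygy k C) : IsSyzygy (k + 1) A :=
  ⟨hA, h.shortComplex, h.shortExact, ⟨Iso.refl _⟩, hB, hB', hC⟩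

lemma IsSyzygy.of_projective (k : ℕ) (P : ModuleCat.{u} R) [hP : Module.Finite R P]
    [hP' : Module.Projective R P] : IsSyzygy k P := by
  have h₀ : ∀ k, IsSyzygy k (ModuleCat.of R PUnit.{u + 1}) := by
    intro k
    induction k with
    | zero => exact inferInstanceAs (Module.Finite R PUnit.{u + 1})
    | succ k ih =>
      refine IsSES.isSyzygy_succ (B := ModuleCat.of R PUnit.{u + 1}) (f := LinearMap.id) (g := 0)
        ⟨Function.injective_id, ?_, fun x => ⟨0, rfl⟩⟩
        (inferInstanceAs (Module.Finite R PUnit.{u + 1}))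
        (inferInstanceAs (Module.Finite R PUnit.{u + 1}))
        (inferInstanceAs (Module.Projective R PUnit.{u + 1})) ih
      exact fun x => ⟨fun _ => ⟨x, rfl⟩, fun _ => rfl⟩
  cases k with
  | zero => exact hP
  | succ k =>
    refine IsSES.isSyzygy_succ (f := LinearMap.id) (g := (0 : P →ₗ[R] PUnit.{u + 1}))
      ⟨Function.injective_id, ?_, fun x => ⟨0, rfl⟩⟩ hP hP hP' (h₀ k)
    exact fun x => ⟨fun _ => ⟨x, rfl⟩, fun _ => rfl⟩

/-- A syzygy in `Ω^{k+1}` is, up to isomorphism, the kernel of an epimorphism from a projective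
module to a syzygy in `Ω^k`. -/
lemma IsSyzygy.exists_isSES {k : ℕ} {C : ModuleCat.{u} R} (h : IsSyzygy (k + 1) C) :
    ∃ (P D : ModuleCat.{u} R) (f : C →ₗ[R] P) (g : P →ₗ[R] D), IsSES f g ∧ Module.Finite R P ∧
      Module.Projective R P ∧ IsSyzygy k D := by
  obtain ⟨-, S, hS, ⟨e⟩, h₁, h₂, h₃⟩ := h
  have hS' := isSES_of_shortExact hS
  refine ⟨S.X₂, S.X₃, S.f.hom ∘ₗ e.toLinearEquiv.symm.toLinearMap, S.g.hom, ⟨?_, ?_, hS'.surjective⟩,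
    h₁, h₂, h₃⟩
  · exact hS'.injective.comp e.toLinearEquiv.symm.injective
  · rw [LinearMap.exact_iff, LinearMap.range_comp, LinearEquiv.range, Submodule.map_top]
    exact hS'.exact.linearMap_ker_eq

/-- Dimension shifting: the modules `Ext^{i+1}` of a `k`-th syzygy are the modules `Ext^{i+1+k}`
of a finitely generated module. -/
lemma IsSyzygy.exists_ext_equiv {k : ℕ} {C : ModuleCat.{u} R} (h : IsSyzygy k C) :
    ∃ C' : ModuleCat.{u} R, Module.Finite R C' ∧ ∀ i, Nonempty
      (Ext C (ModuleCat.of R R) (i + 1) ≃ₗ[Rᵐᵒᵖ] Ext C' (ModuleCat.of R R) (i + 1 + k)) := by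
  induction k generalizing C with
  | zero => exact ⟨C, h, fun i => ⟨.refl _ _⟩⟩
  | succ k ih =>
    obtain ⟨P, D, f, g, hfg, h₁, h₂, h₃⟩ := h.exists_isSES
    obtain ⟨C', hC', e⟩ := ih h₃
    refine ⟨C', hC', fun i => ?_⟩
    obtain ⟨e₁⟩ := e (i + 1)
    have : Module.Projective R hfg.shortComplex.X₂ := h₂
    rw [show i + 1 + (k + 1) = i + 1 + 1 + k by lia]
    exact ⟨(extShiftEquiv hfg.shortExact (add_comm 1 (i + 1))).trans e₁⟩

lemma exists_isSyzygy [IsNoetherianRing R] (k : ℕ) (C' : ModuleCat.{u} R)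
    [hC' : Module.Finite R C'] :
    ∃ C : ModuleCat.{u} R, IsSyzygy k C ∧ ∀ i, Nonempty
      (Ext C (ModuleCat.of R R) (i + 1) ≃ₗ[Rᵐᵒᵖ] Ext C' (ModuleCat.of R R) (i + 1 + k)) := by
  induction k with
  | zero => exact ⟨C', hC', fun i => ⟨.refl _ _⟩⟩
  | succ k ih =>
    obtain ⟨D, hD, e⟩ := ih
    have := hD.finite
    obtain ⟨K, P, f, g, h, hK, hP, hP'⟩ := exists_projective_isSES D
    refine ⟨K, h.isSyzygy_succ hK hP hP' hD, fun i => ?_⟩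
    obtain ⟨e₁⟩ := e (i + 1)
    have : Module.Projective R h.shortComplex.X₂ := hP'
    rw [show i + 1 + (k + 1) = i + 1 + 1 + k by lia]
    exact ⟨(extShiftEquiv h.shortExact (add_comm 1 (i + 1))).trans e₁⟩

lemma isG_iff {n k : ℕ} : IsG R n k ↔ ∀ C : ModuleCat.{u} R, Module.Finite R C → ∀ i < n,
    StrongVanish Rᵐᵒᵖ (i + 1) (Ext C (ModuleCat.of R R) (i + 1 + k)) := by
  simp only [IsG, le_strongGrade_iff]
  constructor
  · exact fun h C hC i hi => h C hC (i + 1) (by lia) (by lia)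
  · intro h C hC i hi hin
    obtain ⟨j, rfl⟩ : ∃ j, i = j + 1 := ⟨i - 1, by lia⟩
    exact h C hC j (by lia)

/-- The condition `G_n(k)` in terms of the modules `Ext^i` of `k`-th syzygies. -/
lemma isG_iff_syzygy [IsNoetherianRing R] {n k : ℕ} : IsG R n k ↔
    ∀ C : ModuleCat.{u} R, IsSyzygy k C → ∀ i < n,
      StrongVanish Rᵐᵒᵖ (i + 1) (Ext C (ModuleCat.of R R) (i + 1)) := by
  rw [isG_iff]
  constructor
  · intro h C hC i hi
    obtain ⟨C', hC', e⟩ := hC.exists_ext_equiv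
    obtain ⟨e₁⟩ := e i
    exact (h C' hC' i hi).of_injective (f := e₁.toLinearMap) e₁.injective
  · intro h C' hC' i hi
    obtain ⟨C, hC, e⟩ := exists_isSyzygy k C'
    obtain ⟨e₁⟩ := e i
    exact (h C hC i hi).of_injective (f := e₁.symm.toLinearMap) e₁.symm.injective

/-- The condition `G_n(k)` in terms of the modules `Ext^1` of higher syzygies. -/
lemma isG_iff_syzygy_one [IsNoetherianRing R] {n k : ℕ} : IsG R n k ↔
    ∀ i < n, ∀ C : ModuleCat.{u} R, IsSyzygy (i + k) C →
      StrongVanish Rᵐᵒᵖ (i + 1) (Ext C (ModuleCat.of R R) 1) := by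
  rw [isG_iff]
  constructor
  · intro h i hi C hC
    obtain ⟨C', hC', e⟩ := hC.exists_ext_equiv
    obtain ⟨e₁⟩ := e 0
    rw [show 0 + 1 + (i + k) = i + 1 + k by lia] at e₁
    exact (h C' hC' i hi).of_injective (f := e₁.toLinearMap) e₁.injective
  · intro h C' hC' i hi
    obtain ⟨C, hC, e⟩ := exists_isSyzygy (i + k) C'
    obtain ⟨e₁⟩ := e 0
    rw [show 0 + 1 + (i + k) = i + 1 + k by lia] at e₁
    exact (h i hi C hC).of_injective (f := e₁.symm.toLinearMap) e₁.symm.injective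

end Syzygy

/-! ### Preservation of monomorphisms -/

section Mono

variable {R : Type u} [Ring R]

lemma extMap_extMap_apply {i : ℕ} {M N : ModuleCat.{u} R} (f : M ⟶ N)
    (x : (extDual Rᵐᵒᵖ i).obj (op ((extDual R i).obj (op M)))) :
    extMap i (extMap i f) x = (Ext.mk₀ (ModuleCat.ofHom (extComp (j := i) (Ext.mk₀ f)
      (zero_add i)))).comp x (zero_add i) := rfl

lemma IsG.injective_extMap_extMap [IsNoetherianRing R] {n k : ℕ} (hG : IsG R n k)
    {S : ShortComplex (ModuleCat.{u} R)} (hS : S.ShortExact) (hC : IsSyzygy k S.X₃) {i : ℕ}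
    (hi : i < n) : Function.Injective (extMap i (extMap i S.f)) := by
  have hSV := isG_iff_syzygy.1 hG S.X₃ hC
  rw [injective_iff_map_eq_zero]
  intro x hx
  rw [extMap_extMap_apply] at hx
  refine ext_injective_of_strongVanish (f := extComp (Ext.mk₀ S.g) (zero_add i))
    (h := extComp hS.extClass (add_comm 1 i)) ?_ ?_ ?_ (hSV i hi) x hx
  · intro z
    constructor
    · exact fun hz => Ext.contravariant_sequence_exact₂ hS _ z hz
    · rintro ⟨w, rfl⟩
      simp
  · intro z
    constructor
    · exact fun hz => Ext.contravariant_sequence_exact₁ hS _ z (add_comm 1 i) hz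
    · rintro ⟨w, rfl⟩
      simp
  · cases i with
    | zero => exact fun _ j hj => absurd hj (Nat.not_lt_zero j)
    | succ i => exact hSV i (by lia)

/-- Pulling back `Ext^i` classes along an epimorphism is injective for `i = 0`; in positive degree
an isomorphism is required. -/
lemma eq_zero_of_mk₀_comp_eq_zero {M N L : Type u} [AddCommGroup M] [Module R M] [AddCommGroup N]
    [Module R N] [AddCommGroup L] [Module R L] {i : ℕ} (π : M →ₗ[R] N)
    (hπ : Function.Surjective π) (hπ' : i ≠ 0 → Function.Injective π)
    (x : Ext (ModuleCat.of R N) (ModuleCat.of R L) i)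
    (hx : (Ext.mk₀ (ModuleCat.ofHom π)).comp x (zero_add i) = 0) : x = 0 := by
  rcases eq_or_ne i 0 with rfl | hi
  · have : Epi (ModuleCat.ofHom π) := (ModuleCat.epi_iff_surjective _).2 hπ
    exact Ext.precomp_mk₀_injective_of_epi _ (ModuleCat.ofHom π)
      (hx.trans (Ext.comp_zero _ _ 0 0 (zero_add 0)).symm)
  · let e := LinearEquiv.ofBijective π ⟨hπ' hi, hπ⟩
    have he : ModuleCat.ofHom e.symm.toLinearMap ≫ ModuleCat.ofHom π =
        𝟙 (ModuleCat.of R N) := by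
      ext z
      exact e.apply_symm_apply z
    rw [← Ext.mk₀_id_comp x, ← he, ← Ext.mk₀_comp_mk₀_assoc, hx, Ext.comp_zero]

/-- A torsionless module `A` embeds in a free module `F` along generators of a submodule of `A^*`,
as soon as the corresponding quotient of `A^*` admits no nonzero functional. Taking for the
submodule the kernel of `A^* → Ext^s(C, R)` given by a class `y ∈ Ext^s(C, A)`, this embedding
also kills `y`. -/
lemma exists_embedding_of_torsionless [IsNoetherianRing Rᵐᵒᵖ] {C A : ModuleCat.{u} R}
    [Module.Finite R A] (hA : Torsionless R A) {s : ℕ} (y : Ext C A s)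
    (hV : StrongVanish Rᵐᵒᵖ 1 (Ext C (ModuleCat.of R R) s)) :
    ∃ (m : ℕ) (ι : A →ₗ[R] (Fin m → R)), Function.Injective ι ∧
      y.comp (Ext.mk₀ (ModuleCat.ofHom ι)) (add_zero s) = 0 ∧
      LinearMap.range (dualMap ι) =
        LinearMap.ker (extComp y (add_zero s) ∘ₗ (dualEquivExt A).toLinearMap) := by
  have : Module.Finite Rᵐᵒᵖ (A →ₗ[R] R) := finite_dual
  set ψ := extComp y (add_zero s) ∘ₗ (dualEquivExt A).toLinearMap with hψ
  obtain ⟨m, φ, hφ⟩ := Submodule.fg_iff_exists_fin_generating_family.1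
    (IsNoetherian.noetherian (LinearMap.ker ψ))
  have hφ' : ∀ l, ψ (φ l) = 0 := fun l => by
    have : φ l ∈ LinearMap.ker ψ := hφ ▸ Submodule.subset_span ⟨l, rfl⟩
    exact this
  have hrange : LinearMap.range (dualMap (LinearMap.pi φ)) = LinearMap.ker ψ := by
    apply le_antisymm
    · rintro _ ⟨θ, rfl⟩
      have : dualMap (LinearMap.pi φ) θ = ∑ l, MulOpposite.op (θ (Pi.single l 1)) • φ l := by
        ext a
        rw [dualMap_apply, LinearMap.comp_apply, pi_eq_sum_univ' (LinearMap.pi φ a), map_sum,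
          LinearMap.sum_apply]
        refine Finset.sum_congr rfl fun l _ => ?_
        rw [map_smul]
        rfl
      rw [this, LinearMap.mem_ker, map_sum]
      exact Finset.sum_eq_zero fun l _ => by rw [map_smul, hφ', smul_zero]
    · rw [← hφ, Submodule.span_le]
      rintro _ ⟨l, rfl⟩
      exact ⟨LinearMap.proj l, rfl⟩
  refine ⟨m, LinearMap.pi φ, ?_, comp_mk₀_pi_eq_zero y φ hφ', hrange⟩
  have hX : ExtVanish Rᵐᵒᵖ 0 (DualCokernel (LinearMap.pi φ)) :=
    hV.extVanish_of_injective
      (f := (LinearMap.range (dualMap (LinearMap.pi φ))).liftQ ψ hrange.le)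
      (LinearMap.ker_eq_bot.1 (Submodule.ker_liftQ_eq_bot _ _ _ hrange.ge)) one_pos
  rw [extVanish_zero_iff] at hX
  rw [injective_iff_map_eq_zero]
  intro a ha
  refine hA a fun φ₀ => ?_
  -- the evaluation at `a` descends to the quotient of `A^*`, where it vanishes
  have h₀ := hX ((LinearMap.range (dualMap (LinearMap.pi φ))).liftQ (evalDual a) (by
    rintro _ ⟨θ, rfl⟩
    rw [LinearMap.mem_ker, evalDual_apply, dualMap_apply, LinearMap.comp_apply, ha, map_zero]
    rfl))
  have h₁ := LinearMap.congr_fun h₀ (Submodule.Quotient.mk φ₀)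
  rw [Submodule.liftQ_apply] at h₁
  exact MulOpposite.op_injective h₁

variable [IsNoetherianRing R] [IsNoetherianRing Rᵐᵒᵖ]

/-- The image of the Yoneda product `Ext^j(A, R) → Ext^{i+1}(C, R)` with a class
`y ∈ Ext^{t+1}(C, A)` has vanishing `Ext^i`. If `t = 0`, then `y` is an extension and the product
is its connecting map, to which the preservation of monomorphisms applies. Otherwise, an embedding
of `A` in a free module killing `y` writes `y` as the product of a class in `Ext^t(C, A')` with an
extension, where `A'` is the cokernel; this decreases `t`, increases `j` and does not change the
image. The torsionfreeness of `A` is what keeps the embeddings available. -/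
lemma extVanish_range_extComp {n k : ℕ}
    (hmono : ∀ S : ShortComplex (ModuleCat.{u} R), S.ShortExact →
      Module.Finite R S.X₁ → Module.Finite R S.X₂ → IsSyzygy k S.X₃ →
      ∀ i : ℕ, i < n → Function.Injective (extMap i (extMap i S.f)))
    {C : ModuleCat.{u} R} (hC : IsSyzygy k C) {i : ℕ} (hi : i < n)
    (hV : ∀ s < i, StrongVanish Rᵐᵒᵖ (s + 1) (Ext C (ModuleCat.of R R) (s + 2)))
    (t : ℕ) {j : ℕ} (h : t + 1 + j = i + 1) {A : ModuleCat.{u} R} [Module.Finite R A]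
    (hA : TransposeVanishUpTo R t A) (y : Ext C A (t + 1))
    (hy : j ≠ 0 → Function.Injective (extComp y h)) :
    ExtVanish Rᵐᵒᵖ i (LinearMap.range (extComp y h)) := by
  have := hC.finite
  induction t generalizing j A with
  | zero =>
    obtain rfl : j = i := by lia
    obtain ⟨B, f, g, hfg, hB, rfl⟩ := exists_extClass_eq y
    have hinj := hmono hfg.shortComplex hfg.shortExact ‹_› hB hC j hi
    rw [injective_iff_map_eq_zero] at hinj
    rw [extVanish_iff]
    intro x
    refine eq_zero_of_mk₀_comp_eq_zero _ (LinearMap.surjective_rangeRestrict _)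
      (fun hj => LinearMap.ker_eq_bot.1
        ((LinearMap.ker_rangeRestrict _).trans (LinearMap.ker_eq_bot.2 (hy hj)))) x ?_
    apply hinj
    refine (extMap_extMap_apply _ _).trans ?_
    rw [Ext.mk₀_comp_mk₀_assoc]
    have hz : ModuleCat.ofHom (extComp (Ext.mk₀ hfg.shortComplex.f) (zero_add j)) ≫
        ModuleCat.ofHom (extComp hfg.shortExact.extClass h).rangeRestrict = 0 := by
      ext z
      exact hfg.shortExact.extClass_comp_assoc z (h := add_comm 1 j)
    rw [hz, Ext.mk₀_zero, Ext.zero_comp]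
    rfl
  | succ t ih =>
    have hV' := hV t (by lia)
    obtain ⟨m, ι, hι, hyι, hrange⟩ := exists_embedding_of_torsionless
      (transposeVanish_one_iff.1 (hA 0 (by lia))) y (hV'.mono (by lia))
    have hses := isSES_mkQ_range hι
    have hfree : Module.Projective R hses.shortComplex.X₂ :=
      inferInstanceAs (Module.Projective R (Fin m → R))
    have hA' : TransposeVanishUpTo R t ((Fin m → R) ⧸ LinearMap.range ι) :=
      hses.transposeVanishUpTo_right (fun j hj => hV'.extVanish_of_injective
        (f := (LinearMap.range (dualMap ι)).liftQ _ hrange.le)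
        (LinearMap.ker_eq_bot.1 (Submodule.ker_liftQ_eq_bot _ _ _ hrange.ge)) hj) hA
    obtain ⟨y', hy'⟩ := Ext.covariant_sequence_exact₁ _ hses.shortExact y hyι rfl
    have h' : t + 1 + (j + 1) = i + 1 := by lia
    have hcomp : extComp y h = extComp y' h' ∘ₗ extComp hses.shortExact.extClass (add_comm 1 j) := by
      ext z
      change y.comp z h = y'.comp (hses.shortExact.extClass.comp z (add_comm 1 j)) h'
      rw [← hy']
      exact Ext.comp_assoc _ _ _ rfl (add_comm 1 j) (by lia)
    have hsurj := extComp_extClass_surjective hses.shortExact (add_comm 1 j)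
    rw [hcomp, LinearMap.range_comp_of_range_eq_top _ (LinearMap.range_eq_top.2 hsurj)]
    refine ih (A := .of R ((Fin m → R) ⧸ LinearMap.range ι)) h' hA' y' fun _ => ?_
    rw [injective_iff_map_eq_zero]
    intro w hw
    obtain ⟨z, rfl⟩ := hsurj w
    have hz : extComp y h z = 0 := by rwa [hcomp]
    rcases eq_or_ne j 0 with rfl | hj
    · obtain rfl : i = t + 1 := by lia
      obtain ⟨α, rfl⟩ := (dualEquivExt A).surjective z
      obtain ⟨β, rfl⟩ : α ∈ LinearMap.range (dualMap ι) := hrange ▸ hz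
      have : dualEquivExt A (dualMap ι β) =
          (Ext.mk₀ hses.shortComplex.f).comp (Ext.mk₀ (ModuleCat.ofHom β)) (zero_add 0) := by
        rw [Ext.mk₀_comp_mk₀]
        rfl
      rw [this]
      exact hses.shortExact.extClass_comp_assoc _ (h := add_comm 1 0)
    · rw [hy hj (hz.trans (map_zero _).symm), map_zero]

/-- Every submodule of `Ext^{i+1}(C, R)` is the image of `Ext^0(F, R)` under the Yoneda product
with a class in `Ext^{i+1}(C, F)` for a free module `F`, which starts the descent of
`extVanish_range_extComp`. The lower degrees come from the induction on `i`, through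
`Ext^{i+1}(C, R) = Ext^i(ΩC, R)`. -/
lemma isG_of_injective_extMap_extMap {n k : ℕ}
    (hmono : ∀ S : ShortComplex (ModuleCat.{u} R), S.ShortExact →
      Module.Finite R S.X₁ → Module.Finite R S.X₂ → IsSyzygy k S.X₃ →
      ∀ i : ℕ, i < n → Function.Injective (extMap i (extMap i S.f))) : IsG R n k := by
  rw [isG_iff_syzygy]
  intro C hC i hi
  induction i using Nat.strong_induction_on generalizing C with
  | _ i ih =>
    have := hC.finite
    have hV : ∀ s < i, StrongVanish Rᵐᵒᵖ (s + 1) (Ext C (ModuleCat.of R R) (s + 2)) := by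
      intro s hs
      obtain ⟨K, P, f, g, h, hK, hP, hP'⟩ := exists_projective_isSES C
      have : Module.Projective R h.shortComplex.X₂ := hP'
      have e := extShiftEquiv h.shortExact (add_comm 1 (s + 1))
      exact (ih s hs K (h.isSyzygy_succ hK hP hP' hC).of_succ (by lia)).of_injective
        (f := e.symm.toLinearMap) e.symm.injective
    intro N j hj
    rcases Nat.lt_succ_iff_lt_or_eq.1 hj with hj | rfl
    · obtain ⟨s, rfl⟩ : ∃ s, i = s + 1 := ⟨i - 1, by lia⟩
      exact hV s (by lia) N j hj
    · have := finite_ext C (j + 1)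
      obtain ⟨m, y, rfl⟩ := exists_range_extComp_eq (IsNoetherian.noetherian N)
      have : Module.Finite R (ModuleCat.of R (Fin m → R)) :=
        inferInstanceAs (Module.Finite R (Fin m → R))
      exact extVanish_range_extComp hmono hC hi hV j (add_zero _)
        (A := ModuleCat.of R (Fin m → R))
        (fun l _ => .of_projective l (Fin m → R)) y (fun h => absurd rfl h)

end Mono

/-! ### Extension closedness -/

section Extension

variable {R : Type u} [Ring R] [IsNoetherianRing R]

/-- Over a ring satisfying `G_n(k)` with `k > 0`, modules in `Ω^{i+k}` are `(i+1)`-torsionfree. -/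
lemma IsG.transposeVanishUpTo {n k : ℕ} (hG : IsG R n k) (hk : 0 < k) {i : ℕ} (hi : i ≤ n)
    {D : ModuleCat.{u} R} (hD : IsSyzygy (i + k) D) : TransposeVanishUpTo R (i + 1) D := by
  have := hD.finite
  induction i generalizing D with
  | zero =>
    obtain ⟨k, rfl⟩ : ∃ k', k = k' + 1 := ⟨k - 1, by lia⟩
    rw [zero_add] at hD
    obtain ⟨P, D', f, g, h, hP, hP', hD'⟩ := hD.exists_isSES
    intro j hj
    obtain rfl : j = 0 := by lia
    exact transposeVanish_one_iff.2 (torsionless_of_projective.of_injective h.injective)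
  | succ i ih =>
    rw [show i + 1 + k = i + k + 1 by lia] at hD
    obtain ⟨P, D', f, g, h, hP, hP', hD'⟩ := hD.exists_isSES
    have := hD'.finite
    obtain ⟨ι, hι, -⟩ := exists_dualCokernel_embedding h.shortExact
    exact h.transposeVanishUpTo_left (fun j hj =>
      (isG_iff_syzygy_one.1 hG i (by lia) D' hD').extVanish_of_injective hι hj)
      (ih (by lia) hD' this)

lemma IsG.isTorsionfree_of_shortExact {n k : ℕ} (hG : IsG R n k) (hk : 0 < k) {i : ℕ} (hi : i < n)
    {S : ShortComplex (ModuleCat.{u} R)} (hS : S.ShortExact) (hA : IsSyzygy (i + k) S.X₁)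
    (hC : IsSyzygy (i + k) S.X₃) : IsTorsionfree (i + 1) S.X₂ := by
  have := hA.finite
  have := hC.finite
  have h := isSES_of_shortExact hS
  obtain ⟨ι, hι, -⟩ := exists_dualCokernel_embedding hS
  refine isTorsionfree_iff.2 ⟨Module.Finite.of_exact h.exact h.surjective, ?_⟩
  exact h.transposeVanishUpTo_middle (fun j hj =>
    (isG_iff_syzygy_one.1 hG i hi _ hC).extVanish_of_injective hι hj)
    (hG.transposeVanishUpTo hk hi.le hA) (hG.transposeVanishUpTo hk hi.le hC)

/-- A submodule of `Ext^1(C, R)` is the cokernel of `B^* → F^*` for an extension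
`0 → F → B → C → 0` with `F` free. As `B` and `C` are torsionfree to the required order, the
transpose sequence makes `Ext` of this cokernel vanish. -/
lemma isG_of_isTorsionfree [IsNoetherianRing Rᵐᵒᵖ] {n k : ℕ}
    (htf : ∀ i : ℕ, i < n → ∀ S : ShortComplex (ModuleCat.{u} R), S.ShortExact →
      IsSyzygy (i + k) S.X₁ → IsSyzygy (i + k) S.X₃ → IsTorsionfree (i + 1) S.X₂) :
    IsG R n k := by
  rw [isG_iff_syzygy_one]
  intro i hi C hC N j hj
  have := hC.finite
  have := finite_ext C 1
  obtain ⟨m, y, rfl⟩ := exists_range_extComp_eq (IsNoetherian.noetherian N)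
  have hfin : Module.Finite R (ModuleCat.of R (Fin m → R)) :=
    inferInstanceAs (Module.Finite R (Fin m → R))
  have hproj : Module.Projective R (ModuleCat.of R (Fin m → R)) :=
    inferInstanceAs (Module.Projective R (Fin m → R))
  obtain ⟨B, f, g, h, hB, rfl⟩ := exists_extClass_eq y
  obtain ⟨ι, hι, hιr⟩ := exists_dualCokernel_embedding h.shortExact
  have hBtf := (isTorsionfree_iff.1
    (htf i hi _ h.shortExact (.of_projective _ _) hC)).2
  -- `C` itself is torsionfree, being the middle term of `0 → 0 → C → C → 0`
  have hCtf : TransposeVanishUpTo R (i + 1) C := by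
    have h₀ : IsSES (0 : PUnit.{u + 1} →ₗ[R] C) (LinearMap.id : C →ₗ[R] C) :=
      ⟨fun _ _ _ => rfl, LinearMap.exact_iff.2 (by simp), Function.surjective_id⟩
    have h₁ : Module.Finite R (ModuleCat.of R PUnit.{u + 1}) :=
      inferInstanceAs (Module.Finite R PUnit.{u + 1})
    have h₂ : Module.Projective R (ModuleCat.of R PUnit.{u + 1}) :=
      inferInstanceAs (Module.Projective R PUnit.{u + 1})
    exact (isTorsionfree_iff.1 (htf i hi _ h₀.shortExact
      (IsSyzygy.of_projective _ (ModuleCat.of R PUnit.{u + 1})) hC)).2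
  refine .of_equiv ((LinearEquiv.ofInjective ι hι).trans (LinearEquiv.ofEq _ _ hιr)).symm ?_
  cases j with
  | zero =>
    exact extVanish_zero_dualCokernel (A := ModuleCat.of R (Fin m → R)) h.injective
      (transposeVanish_one_iff.1 (hBtf 0 (by lia)))
  | succ j =>
    exact h.extVanish_dualCokernel (t := i)
      (fun l => .of_projective l (ModuleCat.of R (Fin m → R))) hBtf
      (fun l hl => hCtf l (by lia)) (by lia)

end Extension

end

end AuslanderType

theorem theorem3p5 (Λ : Type u) [Ring Λ] [IsNoetherianRing Λ] [IsNoetherianRing Λᵐᵒᵖ] (n k : ℕ) :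
    (AuslanderType.IsG Λ n k ↔
      ∀ S : ShortComplex (ModuleCat.{u} Λ), S.ShortExact →
        Module.Finite Λ S.X₁ → Module.Finite Λ S.X₂ → AuslanderType.IsSyzygy k S.X₃ →
        ∀ i : ℕ, i < n →
          Function.Injective (AuslanderType.extMap i (AuslanderType.extMap i S.f))) ∧
    (0 < k →
      (AuslanderType.IsG Λ n k ↔
        ∀ i : ℕ, i < n → ∀ S : ShortComplex (ModuleCat.{u} Λ), S.ShortExact →
          AuslanderType.IsSyzygy (i + k) S.X₁ → AuslanderType.IsSyzygy (i + k) S.X₃ →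
          AuslanderType.IsTorsionfree (i + 1) S.X₂)) :=
  ⟨⟨fun hG _ hS _ _ hC _ hi => hG.injective_extMap_extMap hS hC hi,
      AuslanderType.isG_of_injective_extMap_extMap⟩,
    fun hk => ⟨fun hG _ hi _ hS hA hC => hG.isTorsionfree_of_shortExact hk hi hS hA hC,
      AuslanderType.isG_of_isTorsionfree⟩⟩
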